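/- Let $(M,g)$ be a smooth Riemannian manifold of dimension $n$ and let $q\ge 1$. Notation. For a Euclidean space $V=T_mM$ let $\mathcal D=\Lambda^*V\otimes\Lambda^*V=\bigoplus \mathcal D^{r,s}$ be the algebra of double forms, with product $(\theta_1\otimes\theta_2)(\theta_3\otimes\theta_4)=(\theta_1\wedge\theta_3)\otimes(\theta_2\wedge\theta_4)$; the metric $g$ is an element of $\mathcal D^{1,1}$ and the Riemann curvature tensor $R$ (with the sign for which the unit sphere has $R(x\wedge y,x\wedge y)=1$ for orthonormal $x,y$) an element of $\mathcal D^{2,2}$. Let $c:\mathcal D^{r,s}\to\mathcal D^{r-1,s-1}$ be the contraction $c\omega(x,y)=\sum_j\omega(e_j\wedge x,e_j\wedge y)$ over an orthonormal basis $(e_j)$ (zero if $r=0$ or $s=0$), and let $*(\theta_1\otimes\theta_2)=*\theta_1\otimes *\theta_2$ be the Hodge star. The sectional curvature of $\omega\in\mathcal D^{r,r}$ at an $r$-plane $P$ is $K_\omega(P)=\omega(e_1\wedge\dots\wedge e_r,e_1\wedge\dots\wedge e_r)$, where $(e_1,\dots,e_r)$ is any orthonormal basis of $P$. For $0\le p\le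 n-2q$ the $(p,q)$-curvature $s_{(p,q)}$ is the sectional curvature, on tangent $p$-planes, of $$R_{(p,q)}=\frac{1}{(n-2q-p)!}*\bigl(g^{n-2q-p}R^q\bigr).$$ 1. Let $2q\le p\le n-2q$ and $\lambda\in\mathbb R$. Then $s_{(p,q)}\equiv\lambda$ if and only if the sectional curvature of $R^q$ (on tangent $2q$-planes) is constant and equal to $\dfrac{\lambda\,(2q)!\,(n-p-2q)!}{(n-p)!}$. 2. Let $p<2q$ and $p\le n-2q$. Then $s_{(p,q)}$ is constant if and only if $c^{2q-p}(R^q)=\mathrm{const}\cdot g^p$. Both equivalences hold on $M$ and, more generally, when both sides are required only at the points of an arbitrary subset $S\subseteq M$ (with a constant not depending on the point of $S$); in particular they hold at each single point of $M$. 3. Let $p<2q$ and $m\in M$, and let $R^q=\sum_{i=0}^{2q}g^{2q-i}\omega_i$ at $m$, where each $\omega_i\in\mathcal D^{i,i}$ satisfies $c\,\omega_i=0$. Terms with $i>n-2q$ vanish whatever $\omega_i$ is; assume $\omega_i=0$ for those $i\le p$ with $i>n-2q$ (there are none if $p\le n-2q$). Then $c^{2q-p}(R^q)$ is a constant multiple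 of $g^p$ at $m$ if and only if $\omega_i=0$ for $1\le i\le\min\{p,n-p\}$. -/

import Mathlib

open scoped TensorProduct Manifold ContDiff
open Module Bundle

noncomputable section

/-! ### Double forms on a Euclidean space -/

section DoubleForms

/-- The exterior algebra `Λ*V` of forms on `V`. -/
abbrev Forms (V : Type*) [NormedAddCommGroup V] [InnerProductSpace ℝ V] : Type _ :=
  ExteriorAlgebra ℝ (Dual ℝ V)

/-- The dual space `V*` of 1-forms. -/
abbrev OneForms (V : Type*) [NormedAddCommGroup V] [InnerProductSpace ℝ V] : Type _ :=
  Dual ℝ V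

/-- The algebra of double forms `Λ*V ⊗ Λ*V`. The product is the one of a tensor product of
algebras, `(θ₁ ⊗ θ₂)(θ₃ ⊗ θ₄) = (θ₁ ∧ θ₃) ⊗ (θ₂ ∧ θ₄)`. -/
abbrev DoubleForms (V : Type*) [NormedAddCommGroup V] [InnerProductSpace ℝ V] : Type _ :=
  Forms V ⊗[ℝ] Forms V

variable {V : Type*} [NormedAddCommGroup V] [InnerProductSpace ℝ V] [FiniteDimensional ℝ V]

variable (V) in
/-- The space `D^{p,q} = Λ^pV ⊗ Λ^qV` of double forms of bidegree `(p, q)`. -/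
def bidegree (p q : ℕ) : Submodule ℝ (DoubleForms V) :=
  LinearMap.range (TensorProduct.mapIncl (⋀[ℝ]^p (Dual ℝ V)) (⋀[ℝ]^q (Dual ℝ V)))

/-- The interior product `(i_x θ)(x₂, …, x_p) = θ(x, x₂, …, x_p)`, the antiderivation of the
exterior algebra with `i_x φ = φ x` for a 1-form `φ`. -/
def interiorProduct (x : V) : Forms V →ₗ[ℝ] Forms V :=
  CliffordAlgebra.contractLeft (Dual.eval ℝ V x)

/-- The scalar `θ(x₁, …, x_p)`, that is the degree zero part of `i_{x_p} ⋯ i_{x_1} θ`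
(the parts of `θ` of degree different from `p` contribute zero). -/
def evalForm {p : ℕ} (x : Fin p → V) : Forms V →ₗ[ℝ] ℝ :=
  ExteriorAlgebra.algebraMapInv.toLinearMap ∘ₗ
    (List.ofFn x).foldl (fun T v => interiorProduct v ∘ₗ T) LinearMap.id

/-- The value `η(x₁ ∧ ⋯ ∧ x_p, y₁ ∧ ⋯ ∧ y_q)` of a double form. -/
def evalDouble {p q : ℕ} (x : Fin p → V) (y : Fin q → V) : DoubleForms V →ₗ[ℝ] ℝ :=
  LinearMap.mul' ℝ ℝ ∘ₗ TensorProduct.map (evalForm x) (evalForm y)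

variable (V) in
/-- An orthonormal basis `e₁, …, e_n` of `V` (nothing below depends on which one). -/
def onb : OrthonormalBasis (Fin (finrank ℝ V)) ℝ V := stdOrthonormalBasis ℝ V

variable (V) in
/-- The dual basis `e¹, …, eⁿ` of 1-forms, `eⁱ(x) = ⟨e_i, x⟩`. -/
def coframe (i : Fin (finrank ℝ V)) : Dual ℝ V := (innerSL ℝ (onb V i)).toLinearMap

variable (V) in
/-- The metric as a double form in `D^{1,1}`: `g = ∑ eⁱ ⊗ eⁱ`. -/
def metricForm : DoubleForms V :=
  ∑ i, ExteriorAlgebra.ι ℝ (coframe V i) ⊗ₜ[ℝ] ExteriorAlgebra.ι ℝ (coframe V i)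

/-- The contraction `(cη)(x…, y…) = ∑_j η(e_j ∧ x…, e_j ∧ y…)`. -/
def contraction : DoubleForms V →ₗ[ℝ] DoubleForms V :=
  ∑ j, TensorProduct.map (interiorProduct (onb V j)) (interiorProduct (onb V j))

variable (V) in
/-- The effective elements `E^{p,q}` of `D^{p,q}`: those killed by the contraction. -/
def effective (p q : ℕ) : Submodule ℝ (DoubleForms V) :=
  bidegree V p q ⊓ LinearMap.ker (contraction : DoubleForms V →ₗ[ℝ] DoubleForms V)

variable (V) in
/-- The volume form `e¹ ∧ ⋯ ∧ eⁿ`. -/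
def volumeForm : Forms V := ExteriorAlgebra.ιMulti ℝ (finrank ℝ V) (coframe V)

variable (V) in
/-- The map `φ ↦ i_{φ♯}` from 1-forms to endomorphisms of `Λ*V`, where `φ♯ = ∑ φ(e_j) e_j` is the
vector dual to `φ`. -/
def interiorSharp : Dual ℝ V →ₗ[ℝ] End ℝ (Forms V) :=
  ∑ j, (Dual.eval ℝ V (onb V j)).smulRight (interiorProduct (onb V j))

theorem interiorSharp_apply (φ : Dual ℝ V) :
    interiorSharp V φ = interiorProduct (∑ j, φ (onb V j) • onb V j) := by
  simp [interiorSharp, interiorProduct]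

theorem interiorSharp_sq (φ : Dual ℝ V) : interiorSharp V φ * interiorSharp V φ = 0 := by
  rw [interiorSharp_apply]
  exact LinearMap.ext fun θ => CliffordAlgebra.contractLeft_contractLeft _ θ

/-- The Hodge star of forms, given by
`*(φ₁ ∧ ⋯ ∧ φ_p) = i_{φ_p♯} ⋯ i_{φ_1♯} (e¹ ∧ ⋯ ∧ eⁿ)`; thus
`(*θ)(x_{p+1}, …, x_n) = vol(φ₁♯, …, φ_p♯, x_{p+1}, …, x_n)` for `θ = φ₁ ∧ ⋯ ∧ φ_p`. -/
def hodgeForm : Forms V →ₗ[ℝ] Forms V :=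
  (LinearMap.applyₗ (volumeForm V) : End ℝ (Forms V) →ₗ[ℝ] Forms V) ∘ₗ
    (ExteriorAlgebra.lift ℝ ⟨interiorSharp V, interiorSharp_sq⟩).toLinearMap ∘ₗ
    (CliffordAlgebra.reverse : Forms V →ₗ[ℝ] Forms V)

/-- The Hodge star of double forms, `*(θ₁ ⊗ θ₂) = *θ₁ ⊗ *θ₂`. It does not depend on the
orientation defined by the basis. -/
def hodge : DoubleForms V →ₗ[ℝ] DoubleForms V := TensorProduct.map hodgeForm hodgeForm

/-- The value `K_η(P) = η(e₁ ∧ ⋯ ∧ e_p, e₁ ∧ ⋯ ∧ e_p)` of the sectional curvature of `η` at the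
`p`-plane `P`, computed in the orthonormal basis `e` of `P`. -/
def sectionalCurvature {p : ℕ} (η : DoubleForms V) (P : Submodule ℝ V)
    (e : OrthonormalBasis (Fin p) ℝ P) : ℝ :=
  evalDouble (fun i => (e i : V)) (fun i => (e i : V)) η

/-- The sectional curvature of `η` on `p`-planes is constant and equal to `a`:
`K_η(P) = a` for every `p`-plane `P` (and every orthonormal basis of `P`). -/
def HasConstantSectionalCurvature (p : ℕ) (η : DoubleForms V) (a : ℝ) : Prop :=
  ∀ (P : Submodule ℝ V) (e : OrthonormalBasis (Fin p) ℝ P), sectionalCurvature η P e = a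

/-- For `R` of bidegree `(2, 2)` and `p + 2q ≤ n = dim V`, the `(p, q)`-curvature tensor
`R_{(p,q)} = *(g^{n-2q-p} R^q) / (n-2q-p)!`. -/
def pqCurvatureTensor (R : DoubleForms V) (p q : ℕ) : DoubleForms V :=
  (((finrank ℝ V - 2 * q - p).factorial : ℝ)⁻¹) •
    hodge (metricForm V ^ (finrank ℝ V - 2 * q - p) * R ^ q)

end DoubleForms

/-! ### The Riemann curvature tensor -/

section Curvature

variable {n : ℕ} {M : Type*} [TopologicalSpace M] [ChartedSpace (EuclideanSpace ℝ (Fin n)) M]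
  [IsManifold (𝓡 n) ∞ M] [RiemannianBundle (fun x : M => TangentSpace (𝓡 n) x)]

instance finiteDimensional_tangentSpace (m : M) : FiniteDimensional ℝ (TangentSpace (𝓡 n) m) :=
  inferInstanceAs (FiniteDimensional ℝ (EuclideanSpace ℝ (Fin n)))

/-- The partial derivative `∂_i f`. -/
def partialDeriv (i : Fin n) (f : EuclideanSpace ℝ (Fin n) → ℝ) (y : EuclideanSpace ℝ (Fin n)) :
    ℝ :=
  fderiv ℝ f y (EuclideanSpace.single i 1)

/-- The coordinate vector field `∂_i` of the preferred chart at `m`, at the point with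
coordinates `y`. -/
def coordVector (m : M) (y : EuclideanSpace ℝ (Fin n)) (i : Fin n) :
    TangentSpace (𝓡 n) ((extChartAt (𝓡 n) m).symm y) :=
  mfderiv 𝓘(ℝ, EuclideanSpace ℝ (Fin n)) (𝓡 n) (extChartAt (𝓡 n) m).symm y
    (EuclideanSpace.single i 1 : EuclideanSpace ℝ (Fin n))

/-- The matrix `g_{ij}` of the metric in the preferred chart at `m`, as a function of the
coordinates. -/
def metricMatrix (m : M) (y : EuclideanSpace ℝ (Fin n)) : Matrix (Fin n) (Fin n) ℝ :=
  Matrix.of fun i j => inner ℝ (coordVector m y i) (coordVector m y j)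

/-- The Christoffel symbols
`Γ^k_{ij} = ½ ∑_l g^{kl} (∂_i g_{jl} + ∂_j g_{il} - ∂_l g_{ij})` in the preferred chart at `m`. -/
def christoffelSymbol (m : M) (k i j : Fin n) (y : EuclideanSpace ℝ (Fin n)) : ℝ :=
  (1 / 2) * ∑ l, (metricMatrix m y)⁻¹ k l *
    (partialDeriv i (fun z => metricMatrix m z j l) y
      + partialDeriv j (fun z => metricMatrix m z i l) y
      - partialDeriv l (fun z => metricMatrix m z i j) y)

/-- The components `R^l_{ijk}` in the preferred chart at `m`, where `R(∂_i, ∂_j)∂_k = R^l_{ijk} ∂_l`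
and `R(X, Y) = [∇_X, ∇_Y] - ∇_{[X, Y]}` for the Levi-Civita connection `∇`. -/
def curvatureComponent (m : M) (l i j k : Fin n) (y : EuclideanSpace ℝ (Fin n)) : ℝ :=
  partialDeriv i (christoffelSymbol m l j k) y - partialDeriv j (christoffelSymbol m l i k) y
    + ∑ s, (christoffelSymbol m l i s y * christoffelSymbol m s j k y
      - christoffelSymbol m l j s y * christoffelSymbol m s i k y)

/-- The components `R_{ijkl} = ⟨R(∂_i, ∂_j)∂_l, ∂_k⟩`, with the sign for which the unit sphere has
`R(x ∧ y, x ∧ y) = 1` for orthonormal `x, y`. -/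
def loweredCurvature (m : M) (i j k l : Fin n) (y : EuclideanSpace ℝ (Fin n)) : ℝ :=
  ∑ s, metricMatrix m y k s * curvatureComponent m s i j l y

/-- The differential `dxⁱ` at `m` of the `i`-th coordinate of the preferred chart at `m`. -/
def coordDifferential (m : M) (i : Fin n) : OneForms (TangentSpace (𝓡 n) m) where
  toFun v := EuclideanSpace.proj (𝕜 := ℝ) i
    (mfderiv (𝓡 n) 𝓘(ℝ, EuclideanSpace ℝ (Fin n)) (extChartAt (𝓡 n) m) m v :
      EuclideanSpace ℝ (Fin n))
  map_add' v w := congrArg (EuclideanSpace.proj (𝕜 := ℝ) i)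
    (map_add (mfderiv (𝓡 n) 𝓘(ℝ, EuclideanSpace ℝ (Fin n)) (extChartAt (𝓡 n) m) m) v w)
  map_smul' r v := congrArg (EuclideanSpace.proj (𝕜 := ℝ) i)
    (map_smul (mfderiv (𝓡 n) 𝓘(ℝ, EuclideanSpace ℝ (Fin n)) (extChartAt (𝓡 n) m) m) r v)

variable (n) in
/-- The Riemann curvature tensor at `m` as a double form of bidegree `(2, 2)` on the tangent space,
`R = ¼ ∑ R_{ijkl} (dxⁱ ∧ dxʲ) ⊗ (dxᵏ ∧ dxˡ)`. -/
def riemannForm (m : M) : DoubleForms (TangentSpace (𝓡 n) m) :=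
  (1 / 4 : ℝ) • ∑ i, ∑ j, ∑ k, ∑ l, loweredCurvature m i j k l (extChartAt (𝓡 n) m m) •
    ((ExteriorAlgebra.ι ℝ (coordDifferential m i) * ExteriorAlgebra.ι ℝ (coordDifferential m j))
      ⊗ₜ[ℝ]
    (ExteriorAlgebra.ι ℝ (coordDifferential m k) * ExteriorAlgebra.ι ℝ (coordDifferential m l)))

end Curvature

end

/-! Everything happens pointwise, on one Euclidean space `V` of dimension n. Multiplication by g and
contraction c satisfy cg - gc = n - r - s on D^{r,s} (`slTwoRelations`), and both are nilpotent, so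
double forms carry a representation of sl₂ in which D^{r,r} has weight n - 2r, c raises and g
lowers. Two consequences do most of the work: g^k is injective on weight w when k ≤ w
(`eq_zero_of_lower_pow_eq_zero`), and g^k and c^l have the same kernel on weight k - l
(`lower_pow_eq_zero_iff_raise_pow_eq_zero`).

Sectional curvature determines a double form only under a Bianchi-type condition, here membership in
the span of the squares θ ⊗ θ of decomposable θ. A form of this span with zero sectional curvature
is orthogonal to all these squares, hence to itself, hence zero, because the inner product is
definite. The span contains R by the classical symmetries (`riemannForm_mem_decomposableSquares`)
and g, and is stable under products and the Hodge star. As g^p has sectional curvature p!, constant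
sectional curvature means being a multiple of g^p (`hasConstantSectionalCurvature_iff`).

The star is injective and sends g^k to a multiple of g^{n-k}. So s_{(p,q)} ≡ λ says that g^{n-2q-p}
kills X = R^q - t g^{2q}, with t = λ (n-p-2q)!/(n-p)! (`hasConstant_pqCurvature_iff`). X has weight
n - 4q. If p ≥ 2q, the exponent is at most the weight and X = 0. If p < 2q, the weight is (n-2q-p) -
(2q-p), so the condition becomes c^{2q-p} X = 0. The constants depend only on n, p, q, which gives
the statements over a set of points.

For the effective decomposition, c^{2q-p} turns ∑ g^{2q-i} ω_i into ∑_{i≤p} C_i g^{p-i} ω_i with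
explicit C_i. The summands with i + p ≤ n are determined by such a sum, and g^{p-i} ω_i = 0 for i +
p > n. -/

noncomputable section

/-! ### Weight vectors for the commutation relations of `sl₂` -/

section Sl2

variable {E : Type*} [AddCommGroup E] [Module ℝ E]

/-- The commutation relations of `sl₂` for the operators `H`, `c` (raising) and `g` (lowering). -/
structure SlTwoRelations (H c g : End ℝ E) : Prop where
  comm : ∀ x, c (g x) = g (c x) + H x
  weight_raise : ∀ x, H (c x) = c (H x) + (2 : ℝ) • c x
  weight_lower : ∀ x, H (g x) = g (H x) - (2 : ℝ) • g x

namespace SlTwoRelations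

variable {H c g : End ℝ E}

/-- The relations are symmetric under exchanging the two operators and negating the weight, so each
result about powers of g yields one about powers of c. -/
theorem symm (h : SlTwoRelations H c g) : SlTwoRelations (-H) g c where
  comm x := by rw [h.comm]; simp
  weight_raise x := by simp only [LinearMap.neg_apply, map_neg, h.weight_lower]; module
  weight_lower x := by simp only [LinearMap.neg_apply, map_neg, h.weight_raise]; module

theorem weight_raise_eq (h : SlTwoRelations H c g) {w : ℝ} {x : E} (hx : H x = w • x) :
    H (c x) = (w + 2) • c x := by
  rw [h.weight_raise, hx, map_smul]; module

theorem weight_lower_eq (h : SlTwoRelations H c g) {w : ℝ} {x : E} (hx : H x = w • x) :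
    H (g x) = (w - 2) • g x := by
  rw [h.weight_lower, hx, map_smul]; module

theorem weight_lower_pow (h : SlTwoRelations H c g) {w : ℝ} {x : E} (hx : H x = w • x) (k : ℕ) :
    H ((g ^ k) x) = (w - 2 * k) • (g ^ k) x := by
  induction k with
  | zero => simp [hx]
  | succ k ih =>
    rw [pow_succ', Module.End.mul_apply, h.weight_lower_eq ih]
    push_cast; module

/-- Moving c past k + 1 copies of g collects the weights w, w - 2, …, w - 2k, whose sum is (k + 1)(w
- k). -/
theorem raise_lower_pow (h : SlTwoRelations H c g) {w : ℝ} {x : E} (hx : H x = w • x) (k : ℕ) :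
    c ((g ^ (k + 1)) x) = (g ^ (k + 1)) (c x) + ((k + 1) * (w - k)) • (g ^ k) x := by
  induction k with
  | zero => simp [h.comm, hx]
  | succ k ih =>
    have hp : ∀ (j : ℕ) (y : E), (g ^ (j + 1)) y = g ((g ^ j) y) := fun j y => by
      rw [pow_succ', Module.End.mul_apply]
    rw [hp (k + 1), h.comm, ih, h.weight_lower_pow hx, map_add, map_smul, ← hp, ← hp]
    push_cast; module

/-- On a highest weight vector the term with c x drops out, so each c removes one g at the cost of a
scalar. All nonvanishing arguments below read off the factors of this product. -/
theorem raise_pow_lower_pow (h : SlTwoRelations H c g) {w : ℝ} {x : E} (hx : H x = w • x)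
    (hc : c x = 0) (k l : ℕ) : (c ^ l) ((g ^ (k + l)) x) =
      (∏ t ∈ Finset.range l, ((k + t + 1 : ℝ) * (w - k - t))) • (g ^ k) x := by
  induction l with
  | zero => simp
  | succ l ih =>
    rw [pow_succ, Module.End.mul_apply, ← add_assoc, h.raise_lower_pow hx, hc, map_zero, zero_add,
      map_smul, ih, Finset.prod_range_succ, smul_smul]
    push_cast; ring_nf

theorem raise_pow_lower_pow_eq_zero (h : SlTwoRelations H c g) {w : ℝ} {x : E} (hx : H x = w • x)
    (hc : c x = 0) {k l : ℕ} (hkl : k < l) : (c ^ l) ((g ^ k) x) = 0 := by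
  have h0 := h.raise_pow_lower_pow hx hc 0 k
  rw [zero_add] at h0
  obtain ⟨d, rfl⟩ := Nat.exists_eq_add_of_lt hkl
  rw [show k + d + 1 = (d + 1) + k by ring, pow_add, Module.End.mul_apply, h0, map_smul, pow_succ,
    Module.End.mul_apply, pow_zero, Module.End.one_apply, hc, map_zero, smul_zero]

/-- Powers of the lowering operator are injective on vectors of large weight. -/
theorem eq_zero_of_lower_pow_eq_zero (h : SlTwoRelations H c g) {m : ℕ} {w : ℝ} {x : E}
    (hm : (c ^ m) x = 0) (hx : H x = w • x) {k : ℕ} (hk : (k : ℝ) ≤ w) (hg : (g ^ k) x = 0) :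
    x = 0 := by
  induction m generalizing w x k with
  | zero => simpa using hm
  | succ m ih =>
    have hc : c x = 0 := by
      -- Applying c to g^(k+1) x = 0 gives g^(k+1) (c x) = 0, while the weight of c x is w + 2 ≥ k +
      -- 1. So c x satisfies the hypotheses with a smaller m, and x turns out to be a highest weight
      -- vector.
      refine ih (k := k + 1) ?_ (h.weight_raise_eq hx) (by push_cast; linarith) ?_
      · rwa [← Module.End.mul_apply, ← pow_succ]
      · have := h.raise_lower_pow hx k
        rw [pow_succ' g k, Module.End.mul_apply, hg, map_zero, map_zero, smul_zero, add_zero,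
          ← Module.End.mul_apply, ← pow_succ'] at this
        exact this.symm
    have h0 := h.raise_pow_lower_pow hx hc 0 k
    rw [zero_add, hg, map_zero, pow_zero, Module.End.one_apply] at h0
    refine (smul_eq_zero.1 h0.symm).resolve_left (Finset.prod_ne_zero_iff.2 fun t ht => ?_)
    have : (t : ℝ) + 1 ≤ k := by exact_mod_cast Finset.mem_range.1 ht
    push_cast
    exact mul_ne_zero (by positivity) (by linarith)

/-- Replacing x by c x changes (k, l, w) to (k + 1, l - 1, w + 2) and preserves k - l = w. At l = 0
the exponent equals the weight, and injectivity applies. -/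
theorem raise_pow_eq_zero_of_lower_pow_eq_zero (h : SlTwoRelations H c g)
    (hnil : ∃ m, c ^ m = 0) {w : ℝ} {x : E} (hx : H x = w • x) {k l : ℕ} (hkl : (k : ℝ) - l = w)
    (hg : (g ^ k) x = 0) : (c ^ l) x = 0 := by
  induction l generalizing w x k with
  | zero =>
    obtain ⟨m, hm⟩ := hnil
    exact h.eq_zero_of_lower_pow_eq_zero (m := m) (by simp [hm]) hx
      (by push_cast at hkl; linarith) hg
  | succ l ih =>
    rw [pow_succ, Module.End.mul_apply]
    refine ih (k := k + 1) (h.weight_raise_eq hx) (by push_cast at hkl ⊢; linarith) ?_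
    have := h.raise_lower_pow hx k
    rw [pow_succ' g k, Module.End.mul_apply, hg, map_zero, map_zero, smul_zero, add_zero,
      ← Module.End.mul_apply, ← pow_succ'] at this
    exact this.symm

/-- A power of the lowering operator and the power of the raising operator that ends in the
opposite weight have the same kernel. -/
theorem lower_pow_eq_zero_iff_raise_pow_eq_zero (h : SlTwoRelations H c g)
    (hc : ∃ m, c ^ m = 0) (hg : ∃ m, g ^ m = 0) {w : ℝ} {x : E} (hx : H x = w • x) {k l : ℕ}
    (hkl : (k : ℝ) - l = w) : (g ^ k) x = 0 ↔ (c ^ l) x = 0 :=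
  ⟨h.raise_pow_eq_zero_of_lower_pow_eq_zero hc hx hkl,
    h.symm.raise_pow_eq_zero_of_lower_pow_eq_zero hg (w := -w) (by simp [hx]) (by linarith)⟩

/-- A highest weight vector of weight w generates a string that ends by step w + 1: the vector z =
g^k x is killed by c^(k+1), and this power is injective at the weight of z by the mirrored
injectivity result. -/
theorem lower_pow_eq_zero_of_weight_lt (h : SlTwoRelations H c g) (hnil : ∃ m, g ^ m = 0) {w : ℝ}
    {x : E} (hx : H x = w • x) (hc : c x = 0) {k : ℕ} (hk : w + 1 ≤ k) : (g ^ k) x = 0 := by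
  obtain ⟨m, hm⟩ := hnil
  refine h.symm.eq_zero_of_lower_pow_eq_zero (m := m) (k := k + 1) (w := -(w - 2 * k))
    (by simp [hm]) (by rw [LinearMap.neg_apply, h.weight_lower_pow hx, neg_smul]) (by push_cast; linarith)
    (h.raise_pow_lower_pow_eq_zero hx hc k.lt_succ_self)

/-- The highest weight vectors of a sum of lowered vectors are determined by the sum. -/
theorem eq_zero_of_sum_lower_pow_eq_zero (h : SlTwoRelations H c g) {d : ℝ} {p : ℕ} {y : ℕ → E}
    (hH : ∀ i ≤ p, H (y i) = (d - 2 * i) • y i) (hc : ∀ i ≤ p, c (y i) = 0)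
    (hsum : ∑ i ∈ Finset.range (p + 1), (g ^ (p - i)) (y i) = 0) {i : ℕ} (hi : i ≤ p)
    (hid : (i : ℝ) + p ≤ d) : y i = 0 := by
  induction i using Nat.strong_induction_on with
  | _ i ih =>
    -- Applying c^(p-i) isolates index i: terms with j > i carry too few factors g to survive, and
    -- terms with j < i vanish by the induction hypothesis.
    have h1 : ∑ j ∈ Finset.range (p + 1), (c ^ (p - i)) ((g ^ (p - j)) (y j)) = 0 := by
      rw [← map_sum, hsum, map_zero]
    rw [Finset.sum_eq_single_of_mem i (by simpa [Nat.lt_succ_iff] using hi)] at h1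
    · have h0 := h.raise_pow_lower_pow (hH i hi) (hc i hi) 0 (p - i)
      rw [zero_add, h1, pow_zero, Module.End.one_apply] at h0
      refine (smul_eq_zero.1 h0.symm).resolve_left (Finset.prod_ne_zero_iff.2 fun t ht => ?_)
      have ht' : (t : ℝ) + 1 + i ≤ p := by
        have := Finset.mem_range.1 ht
        exact_mod_cast (by omega : t + 1 + i ≤ p)
      push_cast
      exact mul_ne_zero (by positivity) (by linarith)
    · intro j hj hji
      have hj' : j ≤ p := by simpa [Nat.lt_succ_iff] using hj
      rcases lt_or_gt_of_ne hji with hlt | hgt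
      · have : (j : ℝ) ≤ i := by exact_mod_cast hlt.le
        rw [ih j hlt hj' (by linarith), map_zero, map_zero]
      · exact h.raise_pow_lower_pow_eq_zero (hH j hj') (hc j hj') (by omega)

end SlTwoRelations

end Sl2

/-! ### Sums of commuting elements of square zero -/

section SquareZero

variable {A : Type*} [Ring A]

/-- A monomial of degree exceeding the number of summands repeats one of them. This is the source of
the nilpotency of both g and c. -/
theorem List.sum_pow_succ_length_eq_zero_of_sq_zero (l : List A) (hsq : ∀ x ∈ l, x * x = 0)
    (hcomm : ∀ x ∈ l, ∀ y ∈ l, Commute x y) : l.sum ^ (l.length + 1) = 0 := by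
  induction l with
  | nil => simp
  | cons x l ih =>
    have hx : Commute x l.sum := Commute.list_sum_right _ _ fun y hy =>
      hcomm x (by simp) y (by simp [hy])
    have h0 := ih (fun y hy => hsq y (by simp [hy]))
      fun y hy z hz => hcomm y (by simp [hy]) z (by simp [hz])
    rw [List.sum_cons, List.length_cons, hx.add_pow]
    refine Finset.sum_eq_zero fun m hm => ?_
    rcases Nat.lt_or_ge m 2 with h | h
    · rw [show l.length + 1 + 1 - m = (l.length + 1) + (1 - m) by omega, pow_add, h0]; simp
    · rw [show m = 2 + (m - 2) by omega, pow_add, sq, hsq x (by simp)]; simp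

/-- In top degree only the monomial using each summand once survives, and it occurs once for every
ordering. -/
theorem List.sum_pow_length_of_sq_zero (l : List A) (hsq : ∀ x ∈ l, x * x = 0)
    (hcomm : ∀ x ∈ l, ∀ y ∈ l, Commute x y) : l.sum ^ l.length = l.length.factorial • l.prod := by
  induction l with
  | nil => simp
  | cons x l ih =>
    have hx : Commute x l.sum := Commute.list_sum_right _ _ fun y hy =>
      hcomm x (by simp) y (by simp [hy])
    have hsq' : ∀ y ∈ l, y * y = 0 := fun y hy => hsq y (by simp [hy])
    have hcomm' : ∀ y ∈ l, ∀ z ∈ l, Commute y z :=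
      fun y hy z hz => hcomm y (by simp [hy]) z (by simp [hz])
    have h0 := List.sum_pow_succ_length_eq_zero_of_sq_zero l hsq' hcomm'
    rw [List.sum_cons, List.length_cons, hx.add_pow,
      Finset.sum_eq_single_of_mem 1 (by simp), List.prod_cons]
    · rw [Nat.add_sub_cancel, ih hsq' hcomm', Nat.choose_one_right, pow_one, Nat.factorial_succ,
        mul_comm (l.length + 1), mul_smul, ← nsmul_eq_mul', mul_smul_comm, smul_comm]
    · intro m _ hm
      rcases Nat.lt_or_ge m 2 with h | h
      · rw [show l.length + 1 - m = (l.length + 1) by omega, h0]; simp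
      · rw [show m = 2 + (m - 2) by omega, pow_add, sq, hsq x (by simp)]; simp

end SquareZero

/-! ### Interior products and the number operator -/

section FormsOperators

variable {V : Type*} [NormedAddCommGroup V] [InnerProductSpace ℝ V]

theorem interiorProduct_ι_mul (x : V) (φ : Dual ℝ V) (θ : Forms V) :
    interiorProduct x (ExteriorAlgebra.ι ℝ φ * θ) =
      φ x • θ - ExteriorAlgebra.ι ℝ φ * interiorProduct x θ :=
  CliffordAlgebra.contractLeft_ι_mul _ _ _

theorem interiorProduct_algebraMap (x : V) (t : ℝ) :
    interiorProduct x (algebraMap ℝ (Forms V) t) = 0 :=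
  CliffordAlgebra.contractLeft_algebraMap _ _ _

theorem interiorProduct_one (x : V) : interiorProduct x (1 : Forms V) = 0 :=
  CliffordAlgebra.contractLeft_one _ _

theorem interiorProduct_self (x : V) (θ : Forms V) :
    interiorProduct x (interiorProduct x θ) = 0 :=
  CliffordAlgebra.contractLeft_contractLeft _ _

theorem interiorProduct_swap (x y : V) (θ : Forms V) :
    interiorProduct x (interiorProduct y θ) = -interiorProduct y (interiorProduct x θ) :=
  CliffordAlgebra.contractLeft_comm _ _ _

theorem ι_mul_ι_mul_swap (φ ψ : Dual ℝ V) (θ : Forms V) :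
    ExteriorAlgebra.ι ℝ φ * (ExteriorAlgebra.ι ℝ ψ * θ) =
      -(ExteriorAlgebra.ι ℝ ψ * (ExteriorAlgebra.ι ℝ φ * θ)) := by
  rw [← mul_assoc, ← mul_assoc, ← neg_mul, eq_neg_of_add_eq_zero_left
    (ExteriorAlgebra.ι_add_mul_swap φ ψ)]

theorem ι_mul_ι_mul_self (φ : Dual ℝ V) (θ : Forms V) :
    ExteriorAlgebra.ι ℝ φ * (ExteriorAlgebra.ι ℝ φ * θ) = 0 := by
  rw [← mul_assoc, ExteriorAlgebra.ι_sq_zero, zero_mul]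

variable (V) in
/-- The interior product, as a linear function of the vector. -/
def interiorProductHom : V →ₗ[ℝ] End ℝ (Forms V) :=
  CliffordAlgebra.contractLeft ∘ₗ Dual.eval ℝ V

theorem interiorProductHom_apply (x : V) : interiorProductHom V x = interiorProduct x := rfl

/-- The 1-form dual to a vector. -/
def flatForm : V →ₗ[ℝ] Dual ℝ V where
  toFun x := (innerSL ℝ x).toLinearMap
  map_add' x y := by ext; simp
  map_smul' t x := by ext; simp

theorem flatForm_apply (x y : V) : flatForm x y = inner ℝ x y := rfl

theorem ι_mul_mem (φ : Dual ℝ V) {r : ℕ} {θ : Forms V} (hθ : θ ∈ ⋀[ℝ]^r (Dual ℝ V)) :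
    ExteriorAlgebra.ι ℝ φ * θ ∈ ⋀[ℝ]^(r + 1) (Dual ℝ V) := by
  rw [ExteriorAlgebra.exteriorPower, pow_succ']
  exact Submodule.mul_mem_mul ⟨φ, rfl⟩ hθ

theorem mem_exteriorPower_zero {θ : Forms V} (hθ : θ ∈ ⋀[ℝ]^0 (Dual ℝ V)) :
    ∃ t : ℝ, θ = t • 1 := by
  rw [ExteriorAlgebra.exteriorPower, pow_zero, Submodule.mem_one] at hθ
  obtain ⟨t, rfl⟩ := hθ
  exact ⟨t, Algebra.algebraMap_eq_smul_one t⟩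

theorem interiorProduct_of_mem_zero (x : V) {θ : Forms V} (hθ : θ ∈ ⋀[ℝ]^0 (Dual ℝ V)) :
    interiorProduct x θ = 0 := by
  obtain ⟨t, rfl⟩ := mem_exteriorPower_zero hθ
  rw [map_smul, interiorProduct_one, smul_zero]

theorem interiorProduct_mem (x : V) {r : ℕ} {θ : Forms V} (hθ : θ ∈ ⋀[ℝ]^r (Dual ℝ V)) :
    interiorProduct x θ ∈ ⋀[ℝ]^(r - 1) (Dual ℝ V) := by
  induction hθ using Submodule.pow_induction_on_left' with
  | algebraMap t => rw [interiorProduct_algebraMap]; exact zero_mem _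
  | add θ θ' r _ _ h h' => rw [map_add]; exact add_mem h h'
  | mem_mul m hm r θ hθ h =>
    obtain ⟨φ, rfl⟩ := hm
    rw [interiorProduct_ι_mul]
    refine sub_mem (Submodule.smul_mem _ _ hθ) ?_
    cases r with
    -- Here `r - 1` is truncated, so the second term has no degree to land in and has to vanish.
    | zero => rw [interiorProduct_of_mem_zero x hθ, mul_zero]; exact zero_mem _
    | succ r => exact ι_mul_mem φ h

/-- The reversal of the order of exterior products. -/
def reverseForm : Forms V →ₗ[ℝ] Forms V := CliffordAlgebra.reverse

theorem reverseForm_one : reverseForm (1 : Forms V) = 1 := CliffordAlgebra.reverse.map_one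

theorem reverseForm_mul (θ θ' : Forms V) :
    reverseForm (θ * θ') = reverseForm θ' * reverseForm θ :=
  CliffordAlgebra.reverse.map_mul _ _

theorem reverseForm_ι (φ : Dual ℝ V) :
    reverseForm (ExteriorAlgebra.ι ℝ φ) = ExteriorAlgebra.ι ℝ φ :=
  CliffordAlgebra.reverse_ι _

theorem reverseForm_reverseForm (θ : Forms V) : reverseForm (reverseForm θ) = θ :=
  CliffordAlgebra.reverse_reverse _

theorem reverseForm_mem {r : ℕ} {θ : Forms V} (hθ : θ ∈ ⋀[ℝ]^r (Dual ℝ V)) :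
    reverseForm θ ∈ ⋀[ℝ]^r (Dual ℝ V) := by
  induction hθ using Submodule.pow_induction_on_left' with
  | algebraMap t =>
    rw [Algebra.algebraMap_eq_smul_one, map_smul, reverseForm_one,
      ← Algebra.algebraMap_eq_smul_one]
    exact Submodule.algebraMap_mem t
  | add θ θ' r _ _ h h' => rw [map_add]; exact add_mem h h'
  | mem_mul m hm r θ hθ h =>
    obtain ⟨φ, rfl⟩ := hm
    rw [reverseForm_mul, reverseForm_ι, ExteriorAlgebra.exteriorPower, pow_succ]
    exact Submodule.mul_mem_mul h ⟨φ, rfl⟩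

variable [FiniteDimensional ℝ V]

theorem coframe_eq_flatForm (i : Fin (finrank ℝ V)) : coframe V i = flatForm (onb V i) := rfl

theorem coframe_apply_onb (i j : Fin (finrank ℝ V)) :
    coframe V i (onb V j) = if i = j then 1 else 0 :=
  orthonormal_iff_ite.1 (onb V).orthonormal i j

theorem sum_apply_onb_smul_coframe (φ : Dual ℝ V) : ∑ j, φ (onb V j) • coframe V j = φ := by
  ext v
  conv_rhs => rw [← (onb V).sum_repr' v, map_sum]
  simp [coframe, mul_comm]

theorem sum_coframe_apply_smul_onb (x : V) : ∑ j, coframe V j x • onb V j = x :=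
  (onb V).sum_repr' x

theorem sum_coframe_apply_smul_interiorProduct (x : V) (θ : Forms V) :
    ∑ j, coframe V j x • interiorProduct (onb V j) θ = interiorProduct x θ := by
  conv_rhs => rw [← interiorProductHom_apply, ← sum_coframe_apply_smul_onb x, map_sum]
  simp [LinearMap.sum_apply, interiorProductHom_apply]

variable (V) in
/-- The number operator `∑ e^j ∧ i_{e_j}`, which multiplies a `p`-form by `p`. -/
def numberOp : End ℝ (Forms V) :=
  ∑ j, LinearMap.mulLeft ℝ (ExteriorAlgebra.ι ℝ (coframe V j)) ∘ₗ interiorProduct (onb V j)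

theorem numberOp_apply (θ : Forms V) : numberOp V θ =
    ∑ j, ExteriorAlgebra.ι ℝ (coframe V j) * interiorProduct (onb V j) θ := by
  simp [numberOp, LinearMap.sum_apply]

theorem numberOp_ι_mul (φ : Dual ℝ V) (θ : Forms V) :
    numberOp V (ExteriorAlgebra.ι ℝ φ * θ) =
      ExteriorAlgebra.ι ℝ φ * numberOp V θ + ExteriorAlgebra.ι ℝ φ * θ := by
  simp only [numberOp_apply, interiorProduct_ι_mul, mul_sub, Finset.sum_sub_distrib,
    Finset.mul_sum, mul_smul_comm]
  rw [Finset.sum_congr rfl fun j _ => (ι_mul_ι_mul_swap (coframe V j) φ _), Finset.sum_neg_distrib,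
    sub_neg_eq_add, add_comm]
  congr 1
  conv_rhs => rw [← sum_apply_onb_smul_coframe φ, map_sum, Finset.sum_mul]
  simp

theorem interiorProduct_numberOp (x : V) (θ : Forms V) :
    interiorProduct x (numberOp V θ) = numberOp V (interiorProduct x θ) + interiorProduct x θ := by
  simp only [numberOp_apply, map_sum, interiorProduct_ι_mul, Finset.sum_sub_distrib,
    sum_coframe_apply_smul_interiorProduct]
  rw [Finset.sum_congr rfl fun j _ => congrArg _ (interiorProduct_swap x (onb V j) θ)]
  simp [add_comm]

theorem numberOp_of_mem {r : ℕ} {θ : Forms V} (hθ : θ ∈ ⋀[ℝ]^r (Dual ℝ V)) :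
    numberOp V θ = (r : ℝ) • θ := by
  induction hθ using Submodule.pow_induction_on_left' with
  | algebraMap t => simp [numberOp_apply, interiorProduct_algebraMap]
  | add θ θ' r _ _ h h' => rw [map_add, h, h', smul_add]
  | mem_mul m hm r θ _ h =>
    obtain ⟨φ, rfl⟩ := hm
    rw [numberOp_ι_mul, h, mul_smul_comm]
    push_cast; module

end FormsOperators

/-! ### Operators on double forms -/

section DoubleOperators

variable {V : Type*} [NormedAddCommGroup V] [InnerProductSpace ℝ V]

theorem tmul_mem_bidegree {r s : ℕ} {θ θ' : Forms V} (hθ : θ ∈ ⋀[ℝ]^r (Dual ℝ V))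
    (hθ' : θ' ∈ ⋀[ℝ]^s (Dual ℝ V)) : θ ⊗ₜ[ℝ] θ' ∈ bidegree V r s :=
  ⟨(⟨θ, hθ⟩ : ⋀[ℝ]^r (Dual ℝ V)) ⊗ₜ (⟨θ', hθ'⟩ : ⋀[ℝ]^s (Dual ℝ V)), rfl⟩

/-- Reduces linear statements on a bidegree to simple tensors of homogeneous forms. -/
theorem bidegree_eq_span (r s : ℕ) : bidegree V r s = Submodule.span ℝ
    {η | ∃ θ ∈ ⋀[ℝ]^r (Dual ℝ V), ∃ θ' ∈ ⋀[ℝ]^s (Dual ℝ V), θ ⊗ₜ[ℝ] θ' = η} := by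
  refine le_antisymm ?_ (Submodule.span_le.2 ?_)
  · rintro _ ⟨z, rfl⟩
    induction z using TensorProduct.induction_on with
    | zero => rw [map_zero]; exact zero_mem _
    | tmul x y => exact Submodule.subset_span ⟨x, x.2, y, y.2, rfl⟩
    | add x y hx hy => rw [map_add]; exact add_mem hx hy
  · rintro _ ⟨θ, hθ, θ', hθ', rfl⟩
    exact tmul_mem_bidegree hθ hθ'

theorem bidegree_le_comap {r s : ℕ} {f : DoubleForms V →ₗ[ℝ] DoubleForms V}
    {N : Submodule ℝ (DoubleForms V)} (h : ∀ θ ∈ ⋀[ℝ]^r (Dual ℝ V), ∀ θ' ∈ ⋀[ℝ]^s (Dual ℝ V),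
      f (θ ⊗ₜ[ℝ] θ') ∈ N) : bidegree V r s ≤ N.comap f := by
  rw [bidegree_eq_span, Submodule.span_le]
  rintro _ ⟨θ, hθ, θ', hθ', rfl⟩
  exact h θ hθ θ' hθ'

theorem map_interiorProduct_left_mem (x : V) {r s : ℕ} {η : DoubleForms V}
    (hη : η ∈ bidegree V (r + 1) s) :
    TensorProduct.map (interiorProduct x) LinearMap.id η ∈ bidegree V r s :=
  bidegree_le_comap (f := TensorProduct.map (interiorProduct x) LinearMap.id)
    (fun _ hθ _ hθ' => tmul_mem_bidegree (interiorProduct_mem x hθ) hθ') hη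

theorem map_interiorProduct_right_mem (x : V) {r s : ℕ} {η : DoubleForms V}
    (hη : η ∈ bidegree V r (s + 1)) :
    TensorProduct.map LinearMap.id (interiorProduct x) η ∈ bidegree V r s :=
  bidegree_le_comap (f := TensorProduct.map LinearMap.id (interiorProduct x))
    (fun _ hθ _ hθ' => tmul_mem_bidegree hθ (interiorProduct_mem x hθ')) hη

theorem exists_eq_smul_one {η : DoubleForms V} (hη : η ∈ bidegree V 0 0) :
    ∃ t : ℝ, η = t • (1 : DoubleForms V) := by
  rw [← Submodule.mem_span_singleton.trans (exists_congr fun _ => eq_comm)]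
  refine (bidegree_le_comap (f := LinearMap.id)
    (N := Submodule.span ℝ {(1 : DoubleForms V)}) (fun θ hθ θ' hθ' => ?_) :
    bidegree V 0 0 ≤ _) hη
  obtain ⟨t, rfl⟩ := mem_exteriorPower_zero hθ
  obtain ⟨t', rfl⟩ := mem_exteriorPower_zero hθ'
  refine Submodule.mem_span_singleton.2 ⟨t * t', ?_⟩
  rw [LinearMap.id_apply, TensorProduct.tmul_smul, ← TensorProduct.smul_tmul', smul_smul,
    mul_comm t, Algebra.TensorProduct.one_def]

theorem eq_on_bidegree {E : Type*} [AddCommGroup E] [Module ℝ E] {r s : ℕ}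
    {f f' : DoubleForms V →ₗ[ℝ] E} (h : ∀ θ ∈ ⋀[ℝ]^r (Dual ℝ V),
      ∀ θ' ∈ ⋀[ℝ]^s (Dual ℝ V), f (θ ⊗ₜ[ℝ] θ') = f' (θ ⊗ₜ[ℝ] θ')) {η : DoubleForms V}
    (hη : η ∈ bidegree V r s) : f η = f' η := by
  rw [bidegree_eq_span] at hη
  refine LinearMap.eqOn_span ?_ hη
  rintro _ ⟨θ, hθ, θ', hθ', rfl⟩
  exact h θ hθ θ' hθ'

theorem commute_tmul_ι (φ ψ : Dual ℝ V) :
    Commute (ExteriorAlgebra.ι ℝ φ ⊗ₜ[ℝ] ExteriorAlgebra.ι ℝ φ : DoubleForms V)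
      (ExteriorAlgebra.ι ℝ ψ ⊗ₜ[ℝ] ExteriorAlgebra.ι ℝ ψ) := by
  rw [Commute, SemiconjBy, Algebra.TensorProduct.tmul_mul_tmul,
    Algebra.TensorProduct.tmul_mul_tmul, eq_neg_of_add_eq_zero_left
    (ExteriorAlgebra.ι_add_mul_swap φ ψ), TensorProduct.neg_tmul, TensorProduct.tmul_neg, neg_neg]

/-- The elements φ_i ⊗ φ_i commute, the two signs cancelling, and have square zero. Used for the
full coframe (g^n) and for an orthonormal frame of a p-plane. -/
theorem sum_tmul_ι_pow {k : ℕ} (φ : Fin k → Dual ℝ V) :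
    (∑ i, ExteriorAlgebra.ι ℝ (φ i) ⊗ₜ[ℝ] ExteriorAlgebra.ι ℝ (φ i) : DoubleForms V) ^ k =
      (k.factorial : ℝ) • ExteriorAlgebra.ιMulti ℝ k φ ⊗ₜ[ℝ] ExteriorAlgebra.ιMulti ℝ k φ := by
  have h := List.sum_pow_length_of_sq_zero (List.ofFn fun i =>
    (ExteriorAlgebra.ι ℝ (φ i) ⊗ₜ[ℝ] ExteriorAlgebra.ι ℝ (φ i) : DoubleForms V))
    (by simp)
    (by simpa [List.forall_mem_ofFn_iff] using fun i j => commute_tmul_ι (φ i) (φ j))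
  rw [List.length_ofFn, List.sum_ofFn] at h
  rw [h, Nat.cast_smul_eq_nsmul]
  congr 1
  clear h
  induction k with
  | zero => simp [Algebra.TensorProduct.one_def]
  | succ k ih =>
    rw [List.ofFn_succ, List.prod_cons, ih fun i => φ i.succ, ExteriorAlgebra.ιMulti_succ_apply,
      Algebra.TensorProduct.tmul_mul_tmul]
    rfl

variable [FiniteDimensional ℝ V]

variable (V) in
/-- Multiplication by the metric. -/
def metricMul : End ℝ (DoubleForms V) := LinearMap.mulLeft ℝ (metricForm V)

theorem metricMul_apply (η : DoubleForms V) : metricMul V η = metricForm V * η := rfl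

theorem metricMul_pow_apply (k : ℕ) (η : DoubleForms V) :
    (metricMul V ^ k) η = metricForm V ^ k * η := by
  rw [metricMul, LinearMap.pow_mulLeft, LinearMap.mulLeft_apply]

theorem metricMul_tmul (θ θ' : Forms V) : metricMul V (θ ⊗ₜ θ') =
    ∑ j, (ExteriorAlgebra.ι ℝ (coframe V j) * θ) ⊗ₜ[ℝ]
      (ExteriorAlgebra.ι ℝ (coframe V j) * θ') := by
  simp [metricMul_apply, metricForm, Finset.sum_mul]

theorem contraction_tmul (θ θ' : Forms V) : contraction (θ ⊗ₜ[ℝ] θ') =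
    ∑ j, interiorProduct (onb V j) θ ⊗ₜ[ℝ] interiorProduct (onb V j) θ' := by
  simp [contraction, LinearMap.sum_apply]

variable (V) in
/-- The commutator of contraction and multiplication by the metric, equal to `n - r - s` on double
forms of bidegree `(r, s)`. -/
def weightOp : End ℝ (DoubleForms V) :=
  (finrank ℝ V : ℝ) • LinearMap.id - TensorProduct.map (numberOp V) LinearMap.id -
    TensorProduct.map LinearMap.id (numberOp V)

theorem weightOp_tmul (θ θ' : Forms V) : weightOp V (θ ⊗ₜ[ℝ] θ') =
    (finrank ℝ V : ℝ) • θ ⊗ₜ[ℝ] θ' - numberOp V θ ⊗ₜ[ℝ] θ' - θ ⊗ₜ[ℝ] numberOp V θ' := by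
  simp [weightOp]

theorem weightOp_of_mem {r : ℕ} {η : DoubleForms V} (hη : η ∈ bidegree V r r) :
    weightOp V η = ((finrank ℝ V : ℝ) - 2 * r) • η := by
  refine eq_on_bidegree (f' := ((finrank ℝ V : ℝ) - 2 * r) • LinearMap.id) ?_ hη
  intro θ hθ θ' hθ'
  rw [weightOp_tmul, numberOp_of_mem hθ, numberOp_of_mem hθ', TensorProduct.tmul_smul,
    ← TensorProduct.smul_tmul', LinearMap.smul_apply, LinearMap.id_apply]
  module

variable (V) in
-- Expanding (δ_ij θ - e^i ∧ i_j θ) ⊗ (δ_ij θ' - e^i ∧ i_j θ') over i, j, the squares of δ sum to n,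
-- the mixed terms give minus the number operators of the two factors, and the remaining term is gc.
-- The weight relations hold because c and g change both degrees by one.
theorem slTwoRelations : SlTwoRelations (weightOp V) contraction (metricMul V) where
  comm x := by
    refine LinearMap.congr_fun (f := contraction ∘ₗ metricMul V)
      (g := metricMul V ∘ₗ contraction + weightOp V) (TensorProduct.ext' fun θ θ' => ?_) x
    simp only [LinearMap.comp_apply, LinearMap.add_apply, metricMul_tmul, contraction_tmul,
      map_sum, interiorProduct_ι_mul, TensorProduct.sub_tmul, TensorProduct.tmul_sub,
      coframe_apply_onb, weightOp_tmul, numberOp_apply, TensorProduct.sum_tmul,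
      TensorProduct.tmul_sum, Finset.sum_sub_distrib, ite_smul, one_smul, zero_smul,
      TensorProduct.ite_tmul, TensorProduct.tmul_ite, Finset.sum_ite_eq,
      Finset.mem_univ, if_true, Finset.sum_const, Finset.card_univ, Fintype.card_fin]
    rw [Finset.sum_comm (f := fun x y => (ExteriorAlgebra.ι ℝ (coframe V x) *
      interiorProduct (onb V y) θ) ⊗ₜ[ℝ] (ExteriorAlgebra.ι ℝ (coframe V x) *
      interiorProduct (onb V y) θ'))]
    rw [Nat.cast_smul_eq_nsmul]
    abel
  weight_raise x := by
    refine LinearMap.congr_fun (f := weightOp V ∘ₗ contraction)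
      (g := contraction ∘ₗ weightOp V + (2 : ℝ) • contraction)
      (TensorProduct.ext' fun θ θ' => ?_) x
    simp only [LinearMap.comp_apply, LinearMap.add_apply, LinearMap.smul_apply, contraction_tmul,
      weightOp_tmul, map_sum, map_sub, map_smul, interiorProduct_numberOp, TensorProduct.add_tmul,
      TensorProduct.tmul_add, Finset.sum_sub_distrib, Finset.sum_add_distrib, ← Finset.smul_sum]
    module
  weight_lower x := by
    refine LinearMap.congr_fun (f := weightOp V ∘ₗ metricMul V)
      (g := metricMul V ∘ₗ weightOp V - (2 : ℝ) • metricMul V)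
      (TensorProduct.ext' fun θ θ' => ?_) x
    simp only [LinearMap.comp_apply, LinearMap.sub_apply, LinearMap.smul_apply, metricMul_tmul,
      weightOp_tmul, map_sum, map_sub, map_smul, numberOp_ι_mul, TensorProduct.add_tmul,
      TensorProduct.tmul_add, Finset.sum_sub_distrib, Finset.sum_add_distrib, ← Finset.smul_sum]
    module

variable (V) in
theorem metricForm_pow_finrank : metricForm V ^ finrank ℝ V =
    ((finrank ℝ V).factorial : ℝ) • volumeForm V ⊗ₜ[ℝ] volumeForm V :=
  sum_tmul_ι_pow (coframe V)

variable (V) in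
theorem metricMul_nilpotent : ∃ m, metricMul V ^ m = 0 := by
  refine ⟨finrank ℝ V + 1, ?_⟩
  have h := List.sum_pow_succ_length_eq_zero_of_sq_zero (List.ofFn fun i =>
    (ExteriorAlgebra.ι ℝ (coframe V i) ⊗ₜ[ℝ] ExteriorAlgebra.ι ℝ (coframe V i) : DoubleForms V))
    (by simp)
    (by simpa [List.forall_mem_ofFn_iff] using fun i j => commute_tmul_ι (coframe V i) (coframe V j))
  rw [List.length_ofFn, List.sum_ofFn] at h
  rw [metricMul, LinearMap.pow_mulLeft, metricForm, h, LinearMap.mulLeft_zero_eq_zero]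

variable (V) in
theorem contraction_nilpotent : ∃ m, (contraction : End ℝ (DoubleForms V)) ^ m = 0 := by
  refine ⟨finrank ℝ V + 1, ?_⟩
  have h := List.sum_pow_succ_length_eq_zero_of_sq_zero (A := End ℝ (DoubleForms V))
    (List.ofFn fun i => TensorProduct.map (interiorProduct (onb V i)) (interiorProduct (onb V i)))
    ?_ ?_
  · rwa [List.length_ofFn, List.sum_ofFn] at h
  · simp only [List.forall_mem_ofFn_iff]
    exact fun i => TensorProduct.ext' fun θ θ' => by simp [interiorProduct_self]
  · simp only [List.forall_mem_ofFn_iff]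
    refine fun i j => TensorProduct.ext' fun θ θ' => ?_
    simp [interiorProduct_swap (onb V i) (onb V j), TensorProduct.neg_tmul, TensorProduct.tmul_neg]

end DoubleOperators

/-! ### The inner product of forms -/

section Pairing

variable {V : Type*} [NormedAddCommGroup V] [InnerProductSpace ℝ V] [FiniteDimensional ℝ V]

variable (V) in
/-- The action of forms on forms that extends the interior products by the duals of 1-forms. -/
def sharpAction : Forms V →ₐ[ℝ] End ℝ (Forms V) :=
  ExteriorAlgebra.lift ℝ ⟨interiorSharp V, interiorSharp_sq⟩

theorem sharpAction_ι (φ : Dual ℝ V) :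
    sharpAction V (ExteriorAlgebra.ι ℝ φ) = interiorSharp V φ :=
  ExteriorAlgebra.lift_ι_apply _ _ _ _

theorem interiorSharp_coframe (j : Fin (finrank ℝ V)) :
    interiorSharp V (coframe V j) = interiorProduct (onb V j) := by
  simp [interiorSharp_apply, coframe_apply_onb]

variable (V) in
/-- The inner product of forms, `⟨φ₁ ∧ ⋯ ∧ φ_p, α⟩ = α(φ₁♯, …, φ_p♯)`. -/
def formPairing : LinearMap.BilinForm ℝ (Forms V) :=
  ((sharpAction V).toLinearMap ∘ₗ reverseForm).compr₂ ExteriorAlgebra.algebraMapInv.toLinearMap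

theorem formPairing_apply (θ α : Forms V) : formPairing V θ α =
    ExteriorAlgebra.algebraMapInv (sharpAction V (reverseForm θ) α) := rfl

theorem formPairing_ι_mul (φ : Dual ℝ V) (θ α : Forms V) :
    formPairing V (ExteriorAlgebra.ι ℝ φ * θ) α = formPairing V θ (interiorSharp V φ α) := by
  rw [formPairing_apply, reverseForm_mul, reverseForm_ι, map_mul, sharpAction_ι]
  rfl

theorem formPairing_one (α : Forms V) : formPairing V 1 α = ExteriorAlgebra.algebraMapInv α := by
  rw [formPairing_apply, reverseForm_one, map_one (sharpAction V), Module.End.one_apply]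

variable (V) in
/-- The inner product of double forms. -/
def doublePairing : LinearMap.BilinForm ℝ (DoubleForms V) :=
  LinearMap.BilinForm.tmul (formPairing V) (formPairing V)

theorem doublePairing_tmul (θ θ' α α' : Forms V) :
    doublePairing V (θ ⊗ₜ θ') (α ⊗ₜ α') = formPairing V θ α * formPairing V θ' α' := by
  simp [doublePairing, LinearMap.BilinForm.tmul, mul_comm]

theorem doublePairing_map {f f' h h' : End ℝ (Forms V)}
    (hf : ∀ θ α, formPairing V (f θ) α = formPairing V θ (h α))
    (hf' : ∀ θ α, formPairing V (f' θ) α = formPairing V θ (h' α)) (η ζ : DoubleForms V) :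
    doublePairing V (TensorProduct.map f f' η) ζ =
      doublePairing V η (TensorProduct.map h h' ζ) := by
  induction η using TensorProduct.induction_on with
  | zero => simp
  | add η η' H H' => simp only [map_add, LinearMap.add_apply, H, H']
  | tmul θ θ' =>
    induction ζ using TensorProduct.induction_on with
    | zero => simp
    | add ζ ζ' H H' => simp only [map_add, H, H']
    | tmul α α' => simp only [TensorProduct.map_tmul, doublePairing_tmul, hf, hf']

/-- With L_j adjoint to a_j, (k + 1) B(x, x) = ∑ B(a_j x, a_j x). This passes definiteness from
degree k to degree k + 1 without an orthonormal basis of the exterior powers. -/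
theorem pos_and_definite_of_number {E J : Type*} [AddCommGroup E] [Module ℝ E] [Fintype J]
    (B : LinearMap.BilinForm ℝ E) (L a : J → E → E) (hadj : ∀ j x y, B (L j x) y = B x (a j y))
    {k : ℕ} {x : E} (hx : ((k + 1 : ℕ) : ℝ) • x = ∑ j, L j (a j x)) (hL : ∀ j, L j 0 = 0)
    (h : ∀ j, 0 ≤ B (a j x) (a j x) ∧ (B (a j x) (a j x) = 0 → a j x = 0)) :
    0 ≤ B x x ∧ (B x x = 0 → x = 0) := by
  have hk : (0 : ℝ) < ((k + 1 : ℕ) : ℝ) := by positivity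
  have key : ((k + 1 : ℕ) : ℝ) * B x x = ∑ j, B (a j x) (a j x) := by
    rw [← smul_eq_mul, ← LinearMap.smul_apply, ← map_smul, hx, map_sum, LinearMap.sum_apply]
    exact Finset.sum_congr rfl fun j _ => hadj j _ _
  constructor
  · have : 0 ≤ ((k + 1 : ℕ) : ℝ) * B x x := by
      rw [key]; exact Finset.sum_nonneg fun j _ => (h j).1
    exact nonneg_of_mul_nonneg_right this hk
  · intro h0
    rw [h0, mul_zero, eq_comm, Finset.sum_eq_zero_iff_of_nonneg fun j _ => (h j).1] at key
    have : ((k + 1 : ℕ) : ℝ) • x = 0 := by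
      rw [hx]
      exact Finset.sum_eq_zero fun j hj => by rw [(h j).2 (key j hj), hL]
    exact (smul_eq_zero.1 this).resolve_left hk.ne'

theorem smul_eq_sum_left {r s : ℕ} {η : DoubleForms V} (hη : η ∈ bidegree V r s) :
    (r : ℝ) • η = ∑ j, TensorProduct.map
      (LinearMap.mulLeft ℝ (ExteriorAlgebra.ι ℝ (coframe V j))) LinearMap.id
      (TensorProduct.map (interiorProduct (onb V j)) LinearMap.id η) := by
  have h := eq_on_bidegree (f := (r : ℝ) • LinearMap.id)
    (f' := TensorProduct.map (numberOp V) LinearMap.id) (fun θ hθ θ' _ => by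
      simp [numberOp_of_mem hθ, TensorProduct.smul_tmul']) hη
  rw [LinearMap.smul_apply, LinearMap.id_apply] at h
  rw [h]
  refine (LinearMap.congr_fun (f := TensorProduct.map (numberOp V) LinearMap.id)
    (g := ∑ j, TensorProduct.map (LinearMap.mulLeft ℝ (ExteriorAlgebra.ι ℝ (coframe V j)))
      LinearMap.id ∘ₗ TensorProduct.map (interiorProduct (onb V j)) LinearMap.id)
    (TensorProduct.ext' fun θ θ' => ?_) η).trans (by simp [LinearMap.sum_apply])
  simp [LinearMap.sum_apply, numberOp_apply, TensorProduct.sum_tmul]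

theorem smul_eq_sum_right {r s : ℕ} {η : DoubleForms V} (hη : η ∈ bidegree V r s) :
    (s : ℝ) • η = ∑ j, TensorProduct.map LinearMap.id
      (LinearMap.mulLeft ℝ (ExteriorAlgebra.ι ℝ (coframe V j)))
      (TensorProduct.map LinearMap.id (interiorProduct (onb V j)) η) := by
  have h := eq_on_bidegree (f := (s : ℝ) • LinearMap.id)
    (f' := TensorProduct.map LinearMap.id (numberOp V)) (fun θ _ θ' hθ' => by
      simp [numberOp_of_mem hθ']) hη
  rw [LinearMap.smul_apply, LinearMap.id_apply] at h
  rw [h]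
  refine (LinearMap.congr_fun (f := TensorProduct.map LinearMap.id (numberOp V))
    (g := ∑ j, TensorProduct.map LinearMap.id
      (LinearMap.mulLeft ℝ (ExteriorAlgebra.ι ℝ (coframe V j))) ∘ₗ
        TensorProduct.map LinearMap.id (interiorProduct (onb V j)))
    (TensorProduct.ext' fun θ θ' => ?_) η).trans (by simp [LinearMap.sum_apply])
  simp [LinearMap.sum_apply, numberOp_apply, TensorProduct.tmul_sum]

/-- The inner product of double forms of a given bidegree is positive definite. -/
theorem doublePairing_self {r s : ℕ} {η : DoubleForms V} (hη : η ∈ bidegree V r s) :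
    0 ≤ doublePairing V η η ∧ (doublePairing V η η = 0 → η = 0) := by
  have hadj : ∀ (j : Fin (finrank ℝ V)) (θ α : Forms V),
      formPairing V (LinearMap.mulLeft ℝ (ExteriorAlgebra.ι ℝ (coframe V j)) θ) α =
        formPairing V θ (interiorProduct (onb V j) α) := fun j θ α => by
    rw [LinearMap.mulLeft_apply, formPairing_ι_mul, interiorSharp_coframe]
  induction r generalizing η with
  | zero =>
    induction s generalizing η with
    | zero =>
      obtain ⟨t, rfl⟩ := exists_eq_smul_one hη
      have h1 : doublePairing V 1 1 = 1 := by
        rw [Algebra.TensorProduct.one_def, doublePairing_tmul, formPairing_one,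
          map_one ExteriorAlgebra.algebraMapInv, mul_one]
      simp only [map_smul, LinearMap.smul_apply, h1, smul_eq_mul, mul_one]
      exact ⟨mul_self_nonneg t, fun h => by rw [mul_self_eq_zero.1 h, zero_smul]⟩
    | succ s ih =>
      exact pos_and_definite_of_number (doublePairing V)
        (fun j => TensorProduct.map LinearMap.id
          (LinearMap.mulLeft ℝ (ExteriorAlgebra.ι ℝ (coframe V j))))
        (fun j => TensorProduct.map LinearMap.id (interiorProduct (onb V j)))
        (fun j => doublePairing_map (fun _ _ => rfl) (hadj j)) (smul_eq_sum_right hη)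
        (fun j => LinearMap.map_zero _) fun j => ih (map_interiorProduct_right_mem (onb V j) hη)
  | succ r ih =>
    exact pos_and_definite_of_number (doublePairing V)
      (fun j => TensorProduct.map (LinearMap.mulLeft ℝ (ExteriorAlgebra.ι ℝ (coframe V j)))
        LinearMap.id)
      (fun j => TensorProduct.map (interiorProduct (onb V j)) LinearMap.id)
      (fun j => doublePairing_map (hadj j) (fun _ _ => rfl)) (smul_eq_sum_left hη)
      (fun j => LinearMap.map_zero _) fun j => ih (map_interiorProduct_left_mem (onb V j) hη)

end Pairing

/-! ### Decomposable forms -/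

section Decomposable

variable {V : Type*} [NormedAddCommGroup V] [InnerProductSpace ℝ V]

/-- The decomposable forms `t φ₁ ∧ ⋯ ∧ φ_r`. -/
def IsDecomposable : ℕ → Forms V → Prop
  | 0, θ => ∃ t : ℝ, θ = t • 1
  | r + 1, θ => ∃ φ θ', IsDecomposable r θ' ∧ θ = ExteriorAlgebra.ι ℝ φ * θ'

namespace IsDecomposable

theorem smul {r : ℕ} {θ : Forms V} (h : IsDecomposable r θ) (t : ℝ) :
    IsDecomposable r (t • θ) := by
  induction r generalizing θ with
  | zero => obtain ⟨u, rfl⟩ := h; exact ⟨t * u, smul_smul _ _ _⟩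
  | succ r ih => obtain ⟨φ, θ', h', rfl⟩ := h; exact ⟨φ, _, ih h', (mul_smul_comm _ _ _).symm⟩

theorem mem {r : ℕ} {θ : Forms V} (h : IsDecomposable r θ) : θ ∈ ⋀[ℝ]^r (Dual ℝ V) := by
  induction r generalizing θ with
  | zero =>
    obtain ⟨t, rfl⟩ := h
    rw [← Algebra.algebraMap_eq_smul_one]
    exact Submodule.algebraMap_mem t
  | succ r ih => obtain ⟨φ, θ', h', rfl⟩ := h; exact ι_mul_mem φ (ih h')

theorem mul {r s : ℕ} {θ θ' : Forms V} (h : IsDecomposable r θ) (h' : IsDecomposable s θ') :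
    IsDecomposable (r + s) (θ * θ') := by
  induction r generalizing θ with
  | zero => obtain ⟨t, rfl⟩ := h; rw [zero_add, smul_mul_assoc, one_mul]; exact h'.smul t
  | succ r ih =>
    obtain ⟨φ, θ₁, h₁, rfl⟩ := h
    rw [Nat.succ_add, mul_assoc]
    exact ⟨φ, _, ih h₁, rfl⟩

theorem ι (φ : Dual ℝ V) : IsDecomposable 1 (ExteriorAlgebra.ι ℝ φ) :=
  ⟨φ, 1, ⟨1, (one_smul _ _).symm⟩, (mul_one _).symm⟩

theorem ιMulti {r : ℕ} (φ : Fin r → Dual ℝ V) :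
    IsDecomposable r (ExteriorAlgebra.ιMulti ℝ r φ) := by
  induction r with
  | zero => rw [ExteriorAlgebra.ιMulti_zero_apply]; exact ⟨1, (one_smul _ _).symm⟩
  | succ r ih => rw [ExteriorAlgebra.ιMulti_succ_apply]; exact ⟨_, _, ih _, rfl⟩

/-- A factor `φ` with `φ x ≠ 0` can be used to replace the other factors by ones vanishing at
`x`. -/
theorem exists_ι_mul_eq {r : ℕ} {θ : Forms V} (h : IsDecomposable r θ) {φ : Dual ℝ V} {x : V}
    (hx : φ x ≠ 0) : ∃ θ', IsDecomposable r θ' ∧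
      ExteriorAlgebra.ι ℝ φ * θ = ExteriorAlgebra.ι ℝ φ * θ' ∧ interiorProduct x θ' = 0 := by
  induction r generalizing θ with
  | zero =>
    obtain ⟨t, rfl⟩ := h
    exact ⟨_, ⟨t, rfl⟩, rfl, by rw [map_smul, interiorProduct_one, smul_zero]⟩
  | succ r ih =>
    obtain ⟨ψ, θ₁, h₁, rfl⟩ := h
    obtain ⟨θ₂, h₂, he, h0⟩ := ih h₁
    refine ⟨_, ⟨ψ - (ψ x / φ x) • φ, θ₂, h₂, rfl⟩, ?_, ?_⟩
    · rw [map_sub, map_smul, sub_mul, mul_sub, smul_mul_assoc, mul_smul_comm, ι_mul_ι_mul_self,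
        smul_zero, sub_zero, ι_mul_ι_mul_swap, he, ← ι_mul_ι_mul_swap]
    · rw [interiorProduct_ι_mul, h0, mul_zero, sub_zero]
      simp [div_mul_cancel₀ _ hx]

/-- If φ x = 0, the contraction passes to the remaining factors. Otherwise these can be chosen to
vanish at x, and contracting just removes φ, up to a scalar. -/
theorem interiorProduct {r : ℕ} {θ : Forms V} (h : IsDecomposable (r + 1) θ) (x : V) :
    IsDecomposable r (interiorProduct x θ) := by
  induction r generalizing θ with
  | zero =>
    obtain ⟨φ, θ', ⟨t, rfl⟩, rfl⟩ := h
    refine ⟨φ x * t, ?_⟩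
    rw [interiorProduct_ι_mul, map_smul, interiorProduct_one, smul_zero, mul_zero, sub_zero,
      smul_smul]
  | succ r ih =>
    obtain ⟨φ, θ', h', rfl⟩ := h
    by_cases hx : φ x = 0
    · exact ⟨-φ, _, ih h', by rw [interiorProduct_ι_mul, hx, zero_smul, zero_sub, map_neg,
        neg_mul]⟩
    · obtain ⟨θ'', h'', he, h0⟩ := h'.exists_ι_mul_eq hx
      rw [he, interiorProduct_ι_mul, h0, mul_zero, sub_zero]
      exact h''.smul _

end IsDecomposable

variable (V) in
/-- The span of the squares `θ ⊗ θ` of decomposable `r`-forms. (These are the double forms of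
bidegree `(r, r)` that satisfy the first Bianchi identity.) -/
def decomposableSquares (r : ℕ) : Submodule ℝ (DoubleForms V) :=
  Submodule.span ℝ {η | ∃ θ, IsDecomposable r θ ∧ θ ⊗ₜ[ℝ] θ = η}

theorem tmul_self_mem_decomposableSquares {r : ℕ} {θ : Forms V} (h : IsDecomposable r θ) :
    θ ⊗ₜ[ℝ] θ ∈ decomposableSquares V r :=
  Submodule.subset_span ⟨θ, h, rfl⟩

theorem decomposableSquares_le_bidegree (r : ℕ) : decomposableSquares V r ≤ bidegree V r r := by
  refine Submodule.span_le.2 ?_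
  rintro _ ⟨θ, hθ, rfl⟩
  exact tmul_mem_bidegree hθ.mem hθ.mem

theorem mul_mem_decomposableSquares {r s : ℕ} {η ζ : DoubleForms V}
    (hη : η ∈ decomposableSquares V r) (hζ : ζ ∈ decomposableSquares V s) :
    η * ζ ∈ decomposableSquares V (r + s) := by
  have h : decomposableSquares V r * decomposableSquares V s ≤ decomposableSquares V (r + s) := by
    rw [decomposableSquares, decomposableSquares, Submodule.span_mul_span]
    refine Submodule.span_le.2 ?_
    rintro _ ⟨_, ⟨θ, hθ, rfl⟩, _, ⟨θ', hθ', rfl⟩, rfl⟩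
    simp only [Algebra.TensorProduct.tmul_mul_tmul]
    exact tmul_self_mem_decomposableSquares (hθ.mul hθ')
  exact h (Submodule.mul_mem_mul hη hζ)

theorem pow_mem_decomposableSquares {r : ℕ} {η : DoubleForms V}
    (hη : η ∈ decomposableSquares V r) (k : ℕ) : η ^ k ∈ decomposableSquares V (r * k) := by
  induction k with
  | zero =>
    rw [pow_zero, Algebra.TensorProduct.one_def]
    exact tmul_self_mem_decomposableSquares ⟨1, (one_smul _ _).symm⟩
  | succ k ih => rw [pow_succ]; exact mul_mem_decomposableSquares ih hη

variable [FiniteDimensional ℝ V]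

theorem metricForm_mem_decomposableSquares : metricForm V ∈ decomposableSquares V 1 :=
  sum_mem fun _ _ => tmul_self_mem_decomposableSquares (IsDecomposable.ι _)

theorem metricForm_pow_mem_decomposableSquares (k : ℕ) :
    metricForm V ^ k ∈ decomposableSquares V k := by
  simpa using pow_mem_decomposableSquares metricForm_mem_decomposableSquares k

/-- Being orthogonal to the generators, η is orthogonal to their span and so to itself. -/
theorem eq_zero_of_doublePairing_eq_zero {r : ℕ} {η : DoubleForms V}
    (hη : η ∈ decomposableSquares V r)
    (h : ∀ θ, IsDecomposable r θ → doublePairing V (θ ⊗ₜ θ) η = 0) : η = 0 := by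
  refine (doublePairing_self (decomposableSquares_le_bidegree r hη)).2 ?_
  have : decomposableSquares V r ≤ LinearMap.ker ((doublePairing V).flip η) := by
    refine Submodule.span_le.2 ?_
    rintro _ ⟨θ, hθ, rfl⟩
    exact h θ hθ
  exact this hη

end Decomposable

/-! ### Evaluation of forms on vectors -/

section Evaluation

variable {V : Type*} [NormedAddCommGroup V] [InnerProductSpace ℝ V]

theorem foldl_interiorProduct (l : List V) (T : Forms V →ₗ[ℝ] Forms V) :
    l.foldl (fun T v => interiorProduct v ∘ₗ T) T =
      l.foldl (fun T v => interiorProduct v ∘ₗ T) LinearMap.id ∘ₗ T := by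
  induction l generalizing T with
  | nil => rfl
  | cons v l ih =>
    rw [List.foldl_cons, List.foldl_cons, ih, ih (interiorProduct v ∘ₗ LinearMap.id)]
    rfl

theorem evalForm_zero (x : Fin 0 → V) (θ : Forms V) :
    evalForm x θ = ExteriorAlgebra.algebraMapInv θ := rfl

theorem evalForm_succ {p : ℕ} (x : Fin (p + 1) → V) (θ : Forms V) :
    evalForm x θ = evalForm (fun i => x i.succ) (interiorProduct (x 0) θ) := by
  rw [evalForm, List.ofFn_succ, List.foldl_cons, foldl_interiorProduct]
  rfl

theorem evalDouble_tmul {p q : ℕ} (x : Fin p → V) (y : Fin q → V) (θ θ' : Forms V) :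
    evalDouble x y (θ ⊗ₜ[ℝ] θ') = evalForm x θ * evalForm y θ' := rfl

theorem evalDouble_succ {p q : ℕ} (x : Fin (p + 1) → V) (y : Fin (q + 1) → V)
    (η : DoubleForms V) : evalDouble x y η =
      evalDouble (fun i => x i.succ) (fun i => y i.succ)
        (TensorProduct.map (interiorProduct (x 0)) (interiorProduct (y 0)) η) := by
  refine LinearMap.congr_fun (g := evalDouble (fun i => x i.succ) (fun i => y i.succ) ∘ₗ
    TensorProduct.map (interiorProduct (x 0)) (interiorProduct (y 0)))
    (TensorProduct.ext' fun θ θ' => ?_) η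
  rw [LinearMap.comp_apply, TensorProduct.map_tmul, evalDouble_tmul, evalDouble_tmul,
    evalForm_succ, evalForm_succ]

/-- The evaluation of a form, as an alternating map. -/
def evalAlternating (p : ℕ) (θ : Forms V) : V [⋀^Fin p]→ₗ[ℝ] ℝ :=
  (ExteriorAlgebra.algebraMapInv.toLinearMap ∘ₗ LinearMap.applyₗ θ ∘ₗ
    (ExteriorAlgebra.lift ℝ ⟨interiorProductHom V, fun x =>
      LinearMap.ext fun θ => interiorProduct_self x θ⟩).toLinearMap ∘ₗ
    (CliffordAlgebra.reverse : ExteriorAlgebra ℝ V →ₗ[ℝ] ExteriorAlgebra ℝ V)).compAlternatingMap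
    (ExteriorAlgebra.ιMulti ℝ p)

theorem evalAlternating_apply {p : ℕ} (θ : Forms V) (x : Fin p → V) :
    evalAlternating p θ x = evalForm x θ := by
  have hr : ∀ z : ExteriorAlgebra ℝ V, ∀ v : V,
      (CliffordAlgebra.reverse : ExteriorAlgebra ℝ V →ₗ[ℝ] ExteriorAlgebra ℝ V)
        (ExteriorAlgebra.ι ℝ v * z) =
      (CliffordAlgebra.reverse : ExteriorAlgebra ℝ V →ₗ[ℝ] ExteriorAlgebra ℝ V) z *
        ExteriorAlgebra.ι ℝ v := fun z v =>
    (CliffordAlgebra.reverse.map_mul _ _).trans (congrArg _ (CliffordAlgebra.reverse_ι _))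
  have h1 : (CliffordAlgebra.reverse : ExteriorAlgebra ℝ V →ₗ[ℝ] ExteriorAlgebra ℝ V) 1 = 1 :=
    CliffordAlgebra.reverse.map_one
  induction p generalizing θ with
  | zero =>
    simp only [evalAlternating, LinearMap.compAlternatingMap_apply, LinearMap.comp_apply,
      ExteriorAlgebra.ιMulti_zero_apply, h1]
    simp [evalForm_zero]
  | succ p ih =>
    rw [evalForm_succ, ← ih]
    simp only [evalAlternating, LinearMap.compAlternatingMap_apply, LinearMap.comp_apply,
      ExteriorAlgebra.ιMulti_succ_apply, hr]
    simp only [AlgHom.toLinearMap_apply, LinearMap.applyₗ_apply_apply, map_mul,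
      ExteriorAlgebra.lift_ι_apply, Module.End.mul_apply]
    rfl

/-- A double form that vanishes on orthonormal frames vanishes on all frames. -/
theorem evalDouble_self_eq_zero {p : ℕ} {η : DoubleForms V}
    (h : ∀ (P : Submodule ℝ V) (e : OrthonormalBasis (Fin p) ℝ P), sectionalCurvature η P e = 0)
    (x : Fin p → V) : evalDouble x x η = 0 := by
  by_cases hx : LinearIndependent ℝ x
  · set P := Submodule.span ℝ (Set.range x) with hP
    have hfin : finrank ℝ P = p := by rw [hP, finrank_span_eq_card hx, Fintype.card_fin]
    have : FiniteDimensional ℝ P := FiniteDimensional.span_of_finite ℝ (Set.finite_range x)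
    let e : OrthonormalBasis (Fin p) ℝ P := (stdOrthonormalBasis ℝ P).reindex (finCongr hfin)
    let x' : Fin p → P := fun i => ⟨x i, Submodule.subset_span ⟨i, rfl⟩⟩
    -- An alternating p-form on the p-dimensional space P is a multiple of the determinant. Both
    -- tensor factors acquire the same determinant, so the double form is multiplied by its square.
    have key : ∀ θ : Forms V,
        evalForm x θ = evalForm (fun i => (e i : V)) θ * e.toBasis.det x' := fun θ => by
      have := AlternatingMap.eq_smul_basis_det e.toBasis
        ((evalAlternating p θ).compLinearMap P.subtype)
      have := congrArg (fun f : P [⋀^Fin p]→ₗ[ℝ] ℝ => f x') this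
      simpa [AlternatingMap.compLinearMap_apply, evalAlternating_apply, x',
        Function.comp_def] using this
    have : evalDouble x x η =
        (e.toBasis.det x' * e.toBasis.det x') *
          evalDouble (fun i => (e i : V)) (fun i => (e i : V)) η := by
      refine LinearMap.congr_fun (g := (e.toBasis.det x' * e.toBasis.det x') •
        evalDouble (fun i => (e i : V)) (fun i => (e i : V)))
        (TensorProduct.ext' fun θ θ' => ?_) η
      rw [LinearMap.smul_apply, evalDouble_tmul, evalDouble_tmul, key, key, smul_eq_mul]
      ring
    rw [this]
    exact mul_eq_zero_of_right _ (h P e)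
  · have key : ∀ θ : Forms V, evalForm x θ = 0 := fun θ => by
      rw [← evalAlternating_apply]
      exact AlternatingMap.map_linearDependent _ _ hx
    refine LinearMap.congr_fun (g := 0) (TensorProduct.ext' fun θ θ' => ?_) η
    rw [evalDouble_tmul, key, zero_mul, LinearMap.zero_apply]

theorem evalForm_ιMulti_flatForm {p : ℕ} {e : Fin p → V} (he : Orthonormal ℝ e) :
    evalForm e (ExteriorAlgebra.ιMulti ℝ p fun i => flatForm (e i)) = 1 := by
  induction p with
  | zero => rw [ExteriorAlgebra.ιMulti_zero_apply, evalForm_zero,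
      map_one ExteriorAlgebra.algebraMapInv]
  | succ p ih =>
    -- Contraction by e 0 kills a product of covectors that vanish at e 0; by orthogonality this
    -- applies to the remaining factors of the frame.
    have h0 : ∀ (m : ℕ) (f : Fin m → V), (∀ i, flatForm (f i) (e 0) = 0) → interiorProduct (e 0)
        (ExteriorAlgebra.ιMulti ℝ m fun i => flatForm (f i)) = 0 := by
      intro m f hf
      induction m with
      | zero => rw [ExteriorAlgebra.ιMulti_zero_apply, interiorProduct_one]
      | succ m ihm =>
        rw [ExteriorAlgebra.ιMulti_succ_apply, interiorProduct_ι_mul, hf, zero_smul]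
        erw [ihm (fun i => f i.succ) fun i => hf i.succ]
        rw [mul_zero, sub_zero]
    rw [evalForm_succ, ExteriorAlgebra.ιMulti_succ_apply, interiorProduct_ι_mul]
    erw [h0 p (fun i => e i.succ) fun i => he.2 (Fin.succ_ne_zero i)]
    rw [mul_zero, sub_zero, flatForm_apply, real_inner_self_eq_norm_sq, he.1, one_pow, one_smul]
    exact ih (he.comp _ (Fin.succ_injective p))

theorem interiorProduct_tmul_mul_left (x y : V) (η : DoubleForms V) :
    TensorProduct.map (interiorProduct x) LinearMap.id
      (ExteriorAlgebra.ι ℝ (flatForm y) ⊗ₜ[ℝ] ExteriorAlgebra.ι ℝ (flatForm y) * η) =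
      flatForm y x • (1 ⊗ₜ[ℝ] ExteriorAlgebra.ι ℝ (flatForm y) * η) -
      ExteriorAlgebra.ι ℝ (flatForm y) ⊗ₜ[ℝ] ExteriorAlgebra.ι ℝ (flatForm y) *
        TensorProduct.map (interiorProduct x) LinearMap.id η := by
  induction η using TensorProduct.induction_on with
  | zero => simp
  | add η ζ h h' => simp only [mul_add, map_add, h, h', smul_add]; abel
  | tmul θ θ' => simp [interiorProduct_ι_mul, TensorProduct.sub_tmul, TensorProduct.smul_tmul']

theorem interiorProduct_tmul_mul_right (x y : V) (η : DoubleForms V) :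
    TensorProduct.map LinearMap.id (interiorProduct x)
      (ExteriorAlgebra.ι ℝ (flatForm y) ⊗ₜ[ℝ] ExteriorAlgebra.ι ℝ (flatForm y) * η) =
      flatForm y x • (ExteriorAlgebra.ι ℝ (flatForm y) ⊗ₜ[ℝ] 1 * η) -
      ExteriorAlgebra.ι ℝ (flatForm y) ⊗ₜ[ℝ] ExteriorAlgebra.ι ℝ (flatForm y) *
        TensorProduct.map LinearMap.id (interiorProduct x) η := by
  induction η using TensorProduct.induction_on with
  | zero => simp
  | add η ζ h h' => simp only [mul_add, map_add, h, h', smul_add]; abel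
  | tmul θ θ' => simp [interiorProduct_ι_mul, TensorProduct.tmul_sub]

/-- All interior products by the frame can be moved past h, with two cancelling signs for each
vector, until only the degree zero part of a multiple of h is left. -/
theorem evalDouble_mul_eq_zero {p : ℕ} (e : Fin p → V) {h : DoubleForms V}
    (hl : ∀ i η, TensorProduct.map (interiorProduct (e i)) LinearMap.id (h * η) =
      -(h * TensorProduct.map (interiorProduct (e i)) LinearMap.id η))
    (hr : ∀ i η, TensorProduct.map LinearMap.id (interiorProduct (e i)) (h * η) =
      -(h * TensorProduct.map LinearMap.id (interiorProduct (e i)) η))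
    (h0 : ∀ η, evalDouble (Fin.elim0 : Fin 0 → V) (Fin.elim0 : Fin 0 → V) (h * η) = 0)
    (η : DoubleForms V) : evalDouble e e (h * η) = 0 := by
  induction p generalizing η with
  | zero => rw [Subsingleton.elim e Fin.elim0]; exact h0 η
  | succ p ih =>
    have hc : ∀ ζ, TensorProduct.map (interiorProduct (e 0)) (interiorProduct (e 0)) ζ =
        TensorProduct.map (interiorProduct (e 0)) LinearMap.id
          (TensorProduct.map LinearMap.id (interiorProduct (e 0)) ζ) := fun ζ => by
      rw [← LinearMap.comp_apply, ← TensorProduct.map_comp, LinearMap.comp_id, LinearMap.id_comp]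
    rw [evalDouble_succ, hc, hr, map_neg, hl, neg_neg]
    exact ih _ (fun i => hl i.succ) (fun i => hr i.succ) _

theorem evalDouble_elim0_tmul_ι_mul (φ ψ : Dual ℝ V) (η : DoubleForms V) :
    evalDouble (Fin.elim0 : Fin 0 → V) (Fin.elim0 : Fin 0 → V)
      (ExteriorAlgebra.ι ℝ φ ⊗ₜ[ℝ] ExteriorAlgebra.ι ℝ ψ * η) = 0 := by
  induction η using TensorProduct.induction_on with
  | zero => simp
  | add η ζ h h' => rw [mul_add, map_add, h, h', add_zero]
  | tmul θ θ' =>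
    rw [Algebra.TensorProduct.tmul_mul_tmul, evalDouble_tmul, evalForm_zero,
      map_mul ExteriorAlgebra.algebraMapInv]
    simp [ExteriorAlgebra.algebraMapInv]

variable [FiniteDimensional ℝ V]

/-- Exterior multiplication by φ is adjoint to contraction by φ♯, so pairing with φ₁ ∧ ⋯ ∧ φ_r
evaluates at the dual vectors. This links the inner product to sectional curvature. -/
theorem IsDecomposable.exists_formPairing_eq {r : ℕ} {θ : Forms V} (h : IsDecomposable r θ) :
    ∃ (t : ℝ) (x : Fin r → V), ∀ α, formPairing V θ α = t * evalForm x α := by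
  induction r generalizing θ with
  | zero =>
    obtain ⟨t, rfl⟩ := h
    refine ⟨t, Fin.elim0, fun α => ?_⟩
    rw [map_smul, LinearMap.smul_apply, formPairing_one, evalForm_zero, smul_eq_mul]
  | succ r ih =>
    obtain ⟨φ, θ', h', rfl⟩ := h
    obtain ⟨t, x, hx⟩ := ih h'
    refine ⟨t, Fin.cons (∑ j, φ (onb V j) • onb V j) x, fun α => ?_⟩
    rw [formPairing_ι_mul, hx, evalForm_succ, interiorSharp_apply]
    rfl

/-- In the span of the squares of decomposable forms, a double form is determined by its sectional
curvature. -/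
theorem eq_zero_of_sectionalCurvature_eq_zero {p : ℕ} {η : DoubleForms V}
    (hη : η ∈ decomposableSquares V p) (h : HasConstantSectionalCurvature p η 0) : η = 0 := by
  refine eq_zero_of_doublePairing_eq_zero hη fun θ hθ => ?_
  obtain ⟨t, x, hx⟩ := hθ.exists_formPairing_eq
  have : doublePairing V (θ ⊗ₜ θ) η = (t * t) * evalDouble x x η := by
    refine LinearMap.congr_fun (g := (t * t) • evalDouble x x)
      (TensorProduct.ext' fun α α' => ?_) η
    rw [doublePairing_tmul, hx, hx, LinearMap.smul_apply, evalDouble_tmul, smul_eq_mul]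
    ring
  rw [this, evalDouble_self_eq_zero h, mul_zero]

/-! ### The sectional curvature of powers of the metric -/

theorem flatForm_eq_sum (x : V) : ∑ j, coframe V j x • coframe V j = flatForm x := by
  rw [← sum_apply_onb_smul_coframe (flatForm x)]
  simp [coframe_eq_flatForm, flatForm_apply, real_inner_comm]

/-- The part of the metric transversal to an orthonormal frame anticommutes with the interior
products by the vectors of the frame. -/
theorem interiorProduct_transversal_left {p : ℕ} {e : Fin p → V} (he : Orthonormal ℝ e) (i : Fin p)
    (η : DoubleForms V) :
    TensorProduct.map (interiorProduct (e i)) LinearMap.id ((metricForm V - ∑ k,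
      ExteriorAlgebra.ι ℝ (flatForm (e k)) ⊗ₜ[ℝ] ExteriorAlgebra.ι ℝ (flatForm (e k))) * η) =
    -((metricForm V - ∑ k,
      ExteriorAlgebra.ι ℝ (flatForm (e k)) ⊗ₜ[ℝ] ExteriorAlgebra.ι ℝ (flatForm (e k))) *
        TensorProduct.map (interiorProduct (e i)) LinearMap.id η) := by
  simp only [metricForm, coframe_eq_flatForm, sub_mul, Finset.sum_mul, map_sub, map_sum,
    interiorProduct_tmul_mul_left, Finset.sum_sub_distrib]
  -- The terms in which the vector e i is paired with a covector are the same for the metric and for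
  -- the frame part, and they cancel in the difference.
  have h1 : ∑ k, flatForm (e k) (e i) •
      ((1 : Forms V) ⊗ₜ[ℝ] ExteriorAlgebra.ι ℝ (flatForm (e k)) * η) =
      1 ⊗ₜ[ℝ] ExteriorAlgebra.ι ℝ (flatForm (e i)) * η := by
    simp [flatForm_apply, orthonormal_iff_ite.1 he]
  have h2 : ∑ j, flatForm (onb V j) (e i) •
      ((1 : Forms V) ⊗ₜ[ℝ] ExteriorAlgebra.ι ℝ (flatForm (onb V j)) * η) =
      1 ⊗ₜ[ℝ] ExteriorAlgebra.ι ℝ (flatForm (e i)) * η := by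
    conv_rhs => rw [← flatForm_eq_sum, map_sum, TensorProduct.tmul_sum, Finset.sum_mul]
    simp [coframe_eq_flatForm]
  rw [h1, h2]
  abel

theorem interiorProduct_transversal_right {p : ℕ} {e : Fin p → V} (he : Orthonormal ℝ e)
    (i : Fin p) (η : DoubleForms V) :
    TensorProduct.map LinearMap.id (interiorProduct (e i)) ((metricForm V - ∑ k,
      ExteriorAlgebra.ι ℝ (flatForm (e k)) ⊗ₜ[ℝ] ExteriorAlgebra.ι ℝ (flatForm (e k))) * η) =
    -((metricForm V - ∑ k,
      ExteriorAlgebra.ι ℝ (flatForm (e k)) ⊗ₜ[ℝ] ExteriorAlgebra.ι ℝ (flatForm (e k))) *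
        TensorProduct.map LinearMap.id (interiorProduct (e i)) η) := by
  simp only [metricForm, coframe_eq_flatForm, sub_mul, Finset.sum_mul, map_sub, map_sum,
    interiorProduct_tmul_mul_right, Finset.sum_sub_distrib]
  have h1 : ∑ k, flatForm (e k) (e i) •
      (ExteriorAlgebra.ι ℝ (flatForm (e k)) ⊗ₜ[ℝ] (1 : Forms V) * η) =
      ExteriorAlgebra.ι ℝ (flatForm (e i)) ⊗ₜ[ℝ] 1 * η := by
    simp [flatForm_apply, orthonormal_iff_ite.1 he]
  have h2 : ∑ j, flatForm (onb V j) (e i) •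
      (ExteriorAlgebra.ι ℝ (flatForm (onb V j)) ⊗ₜ[ℝ] (1 : Forms V) * η) =
      ExteriorAlgebra.ι ℝ (flatForm (e i)) ⊗ₜ[ℝ] 1 * η := by
    conv_rhs => rw [← flatForm_eq_sum, map_sum, TensorProduct.sum_tmul, Finset.sum_mul]
    simp [coframe_eq_flatForm, ← TensorProduct.smul_tmul']
  rw [h1, h2]
  abel

/-- The sectional curvature of `g^p` is `p!`. -/
theorem evalDouble_metricForm_pow {p : ℕ} {e : Fin p → V} (he : Orthonormal ℝ e) :
    evalDouble e e (metricForm V ^ p) = p.factorial := by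
  set s : DoubleForms V := ∑ k,
    ExteriorAlgebra.ι ℝ (flatForm (e k)) ⊗ₜ[ℝ] ExteriorAlgebra.ι ℝ (flatForm (e k)) with hs
  have h0 : ∀ η, evalDouble e e ((metricForm V - s) * η) = 0 :=
    evalDouble_mul_eq_zero e (interiorProduct_transversal_left he)
      (interiorProduct_transversal_right he) fun η => by
        simp only [hs, metricForm, sub_mul, Finset.sum_mul, map_sub, map_sum,
          evalDouble_elim0_tmul_ι_mul, Finset.sum_const_zero, sub_zero]
  have hcomm : Commute (metricForm V) s :=
    Commute.sum_left _ _ _ fun i _ => Commute.sum_right _ _ _ fun j _ => commute_tmul_ι _ _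
  have h1 : evalDouble e e (metricForm V ^ p) = evalDouble e e (s ^ p) := by
    -- g^p - s^p is a left multiple of g - s, so only the part s of the metric tangent to the frame
    -- contributes.
    rw [← sub_eq_zero, ← map_sub, ← hcomm.mul_geom_sum₂, h0]
  rw [h1, hs, sum_tmul_ι_pow, map_smul, evalDouble_tmul, evalForm_ιMulti_flatForm he, mul_one,
    smul_eq_mul, mul_one]

/-- Compare η with the multiple of g^p having sectional curvature a, using that g^p has curvature
p!; their difference stays in the span of squares, where curvature is faithful. -/
theorem hasConstantSectionalCurvature_iff {p : ℕ} {η : DoubleForms V}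
    (hη : η ∈ decomposableSquares V p) (a : ℝ) :
    HasConstantSectionalCurvature p η a ↔ η = (a / p.factorial) • metricForm V ^ p := by
  have hf : (p.factorial : ℝ) ≠ 0 := by exact_mod_cast p.factorial_ne_zero
  have hval : ∀ (P : Submodule ℝ V) (e : OrthonormalBasis (Fin p) ℝ P),
      sectionalCurvature ((a / p.factorial) • metricForm V ^ p) P e = a := fun P e => by
    have he : Orthonormal ℝ fun i => (e i : V) := e.orthonormal.comp_linearIsometry P.subtypeₗᵢ
    rw [sectionalCurvature, map_smul, evalDouble_metricForm_pow he, smul_eq_mul,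
      div_mul_cancel₀ _ hf]
  refine ⟨fun h => sub_eq_zero.1 (eq_zero_of_sectionalCurvature_eq_zero (sub_mem hη
    (Submodule.smul_mem _ _ (metricForm_pow_mem_decomposableSquares p))) fun P e => ?_), ?_⟩
  · rw [sectionalCurvature, map_sub]
    exact sub_eq_zero.2 ((h P e).trans (hval P e).symm)
  · rintro rfl
    exact hval

end Evaluation

/-! ### The Hodge star -/

section Hodge

variable {V : Type*} [NormedAddCommGroup V] [InnerProductSpace ℝ V] [FiniteDimensional ℝ V]

theorem hodgeForm_apply (θ : Forms V) :
    hodgeForm θ = sharpAction V (reverseForm θ) (volumeForm V) := rfl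

theorem hodgeForm_mul_ι (θ : Forms V) (φ : Dual ℝ V) :
    hodgeForm (θ * ExteriorAlgebra.ι ℝ φ) = interiorSharp V φ (hodgeForm θ) := by
  rw [hodgeForm_apply, reverseForm_mul, reverseForm_ι, map_mul, sharpAction_ι]
  rfl

/-- Because of the reversal in the star, a factor multiplied on the right becomes the outermost
interior product. -/
theorem hodge_mul_metricForm (η : DoubleForms V) :
    hodge (η * metricForm V) = contraction (hodge η) := by
  refine LinearMap.congr_fun (f := hodge ∘ₗ LinearMap.mulRight ℝ (metricForm V))
    (g := contraction ∘ₗ hodge) (TensorProduct.ext' fun θ θ' => ?_) η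
  simp [metricForm, Finset.mul_sum, hodge, contraction_tmul, hodgeForm_mul_ι,
    interiorSharp_coframe]

theorem one_mem_effective : (1 : DoubleForms V) ∈ effective V 0 0 := by
  refine ⟨decomposableSquares_le_bidegree 0
    (by simpa using metricForm_pow_mem_decomposableSquares 0), ?_⟩
  change contraction (1 : DoubleForms V) = 0
  rw [Algebra.TensorProduct.one_def, contraction_tmul]
  simp [interiorProduct_one]

/-- The form 1 is effective of weight n, so this is one step of its sl₂ string. -/
theorem contraction_metricForm_pow (k : ℕ) : contraction (metricForm V ^ (k + 1)) =
    ((k + 1) * (finrank ℝ V - k) : ℝ) • metricForm V ^ k := by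
  have h := (slTwoRelations V).raise_lower_pow (weightOp_of_mem one_mem_effective.1) k
  have h1 : contraction (1 : DoubleForms V) = 0 := one_mem_effective.2
  rw [h1, map_zero, zero_add, metricMul_pow_apply, metricMul_pow_apply, mul_one, mul_one] at h
  simpa using h

theorem hodge_one : hodge (1 : DoubleForms V) = volumeForm V ⊗ₜ volumeForm V := by
  rw [Algebra.TensorProduct.one_def, hodge, TensorProduct.map_tmul, hodgeForm_apply,
    reverseForm_one, map_one (sharpAction V), Module.End.one_apply]

/-- Start from *1 = g^n / n!; each further factor g becomes a contraction, which lowers the power of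
g by one. -/
theorem hodge_metricForm_pow {k : ℕ} (hk : k ≤ finrank ℝ V) : hodge (metricForm V ^ k) =
    (k.factorial / (finrank ℝ V - k).factorial : ℝ) • metricForm V ^ (finrank ℝ V - k) := by
  induction k with
  | zero =>
    have hf : ((finrank ℝ V).factorial : ℝ) ≠ 0 := by exact_mod_cast Nat.factorial_ne_zero _
    rw [pow_zero, hodge_one, Nat.sub_zero, metricForm_pow_finrank, smul_smul]
    field_simp
    simp
  | succ k ih =>
    obtain ⟨d, hd⟩ := Nat.exists_eq_add_of_le hk
    have hf : (d.factorial : ℝ) ≠ 0 := by exact_mod_cast Nat.factorial_ne_zero _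
    rw [pow_succ, hodge_mul_metricForm, ih (by omega), map_smul,
      show finrank ℝ V - k = d + 1 by omega, show finrank ℝ V - (k + 1) = d by omega,
      contraction_metricForm_pow, smul_smul, Nat.factorial_succ, Nat.factorial_succ, hd]
    congr 1
    push_cast
    field_simp
    ring

theorem interiorSharp_swap (φ ψ : Dual ℝ V) (α : Forms V) :
    ExteriorAlgebra.ι ℝ φ * interiorSharp V ψ α =
      (∑ j, φ (onb V j) * ψ (onb V j)) • α -
        interiorSharp V ψ (ExteriorAlgebra.ι ℝ φ * α) := by
  rw [interiorSharp_apply, interiorProduct_ι_mul, map_sum, sub_sub_eq_add_sub]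
  simp [mul_comm]

theorem interiorSharp_ι_mul (φ ψ : Dual ℝ V) (θ : Forms V) :
    interiorSharp V φ (ExteriorAlgebra.ι ℝ ψ * θ) =
      (∑ j, φ (onb V j) * ψ (onb V j)) • θ - ExteriorAlgebra.ι ℝ ψ * interiorSharp V φ θ := by
  rw [interiorSharp_apply, interiorProduct_ι_mul, map_sum]
  simp

theorem ι_mul_volumeForm (φ : Dual ℝ V) : ExteriorAlgebra.ι ℝ φ * volumeForm V = 0 := by
  rw [← sum_apply_onb_smul_coframe φ, map_sum, Finset.sum_mul]
  refine Finset.sum_eq_zero fun j _ => ?_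
  rw [map_smul, smul_mul_assoc, volumeForm, ExteriorAlgebra.ιMulti_apply,
    ExteriorAlgebra.ι_mul_prod_list, smul_zero]

/-- Exterior multiplication by φ anticommutes with the interior products up to a scalar and kills
the volume form, so on forms contracted from the volume it acts as contraction of the contracting
form. -/
theorem ι_mul_sharpAction (φ : Dual ℝ V) (θ : Forms V) :
    ExteriorAlgebra.ι ℝ φ * sharpAction V θ (volumeForm V) =
      sharpAction V (interiorSharp V φ θ) (volumeForm V) := by
  induction θ using CliffordAlgebra.left_induction with
  | algebraMap t =>
    change ExteriorAlgebra.ι ℝ φ * sharpAction V (algebraMap ℝ (Forms V) t) (volumeForm V) =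
      sharpAction V (interiorSharp V φ (algebraMap ℝ (Forms V) t)) (volumeForm V)
    rw [AlgHom.commutes, interiorSharp_apply, interiorProduct_algebraMap, map_zero,
      LinearMap.zero_apply, Module.algebraMap_end_apply, mul_smul_comm, ι_mul_volumeForm,
      smul_zero]
  | add θ θ' h h' =>
    simp only [map_add, LinearMap.add_apply, mul_add, h, h']
  | ι_mul θ ψ h =>
    have e1 : ∀ θ : Forms V, sharpAction V (ExteriorAlgebra.ι ℝ ψ * θ) (volumeForm V) =
        interiorSharp V ψ (sharpAction V θ (volumeForm V)) := fun θ => by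
      rw [map_mul, sharpAction_ι, Module.End.mul_apply]
    change ExteriorAlgebra.ι ℝ φ * sharpAction V (ExteriorAlgebra.ι ℝ ψ * θ) (volumeForm V) =
      sharpAction V (interiorSharp V φ (ExteriorAlgebra.ι ℝ ψ * θ)) (volumeForm V)
    rw [e1, interiorSharp_swap, h, interiorSharp_ι_mul, map_sub, map_smul, LinearMap.sub_apply,
      LinearMap.smul_apply, e1]

/-- Otherwise g^n would vanish, whereas its Hodge star is the scalar n!. -/
theorem volumeForm_tmul_ne_zero : (volumeForm V ⊗ₜ[ℝ] volumeForm V : DoubleForms V) ≠ 0 := by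
  intro h0
  have h := metricForm_pow_finrank V
  rw [h0, smul_zero] at h
  have h1 := hodge_metricForm_pow (V := V) le_rfl
  have hf : ((finrank ℝ V).factorial : ℝ) ≠ 0 := by exact_mod_cast Nat.factorial_ne_zero _
  rw [h, map_zero, Nat.sub_self, Nat.factorial_zero, Nat.cast_one, div_one, pow_zero, eq_comm,
    smul_eq_zero] at h1
  exact one_ne_zero (h1.resolve_left hf)

variable (V) in
/-- The map `φ₁ ∧ ⋯ ∧ φ_p ↦ i_{φ_1♯} ⋯ i_{φ_p♯} vol`, which is the Hodge star up to sign. -/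
def sharpVolume : Forms V →ₗ[ℝ] Forms V :=
  LinearMap.applyₗ (volumeForm V) ∘ₗ (sharpAction V).toLinearMap

theorem ι_mul_sharpVolume (j : Fin (finrank ℝ V)) (θ : Forms V) :
    sharpVolume V (interiorProduct (onb V j) θ) =
      ExteriorAlgebra.ι ℝ (coframe V j) * sharpVolume V θ := by
  rw [← interiorSharp_coframe]
  exact (ι_mul_sharpAction _ _).symm

/-- The map turns contraction by e_j into multiplication by e^j, so the contractions of η in either
factor are in its kernel as well. They vanish by induction on the bidegree, and the number operator
recovers η from them. -/
theorem map_sharpVolume_eq_zero {r s : ℕ} {η : DoubleForms V} (hη : η ∈ bidegree V r s)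
    (h : TensorProduct.map (sharpVolume V) (sharpVolume V) η = 0) : η = 0 := by
  have hr : ∀ k : ℕ, ((k + 1 : ℕ) : ℝ) ≠ 0 := fun k => by positivity
  induction r generalizing η with
  | zero =>
    induction s generalizing η with
    | zero =>
      obtain ⟨t, rfl⟩ := exists_eq_smul_one hη
      have h1 : sharpVolume V 1 = volumeForm V := by
        rw [sharpVolume, LinearMap.comp_apply, AlgHom.toLinearMap_apply, map_one (sharpAction V)]
        rfl
      rw [map_smul, Algebra.TensorProduct.one_def, TensorProduct.map_tmul, h1] at h
      rw [(smul_eq_zero.1 h).resolve_right volumeForm_tmul_ne_zero, zero_smul]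
    | succ s ih =>
      refine (smul_eq_zero.1 ((smul_eq_sum_right hη).trans
        (Finset.sum_eq_zero fun j _ => ?_))).resolve_left (hr s)
      rw [ih (map_interiorProduct_right_mem (onb V j) hη), map_zero]
      have : TensorProduct.map (sharpVolume V) (sharpVolume V)
          (TensorProduct.map LinearMap.id (interiorProduct (onb V j)) η) =
          TensorProduct.map LinearMap.id
            (LinearMap.mulLeft ℝ (ExteriorAlgebra.ι ℝ (coframe V j)))
            (TensorProduct.map (sharpVolume V) (sharpVolume V) η) := by
        simp only [← LinearMap.comp_apply, ← TensorProduct.map_comp]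
        congr 2
        exact LinearMap.ext fun θ => ι_mul_sharpVolume j θ
      rw [this, h, map_zero]
  | succ r ih =>
    refine (smul_eq_zero.1 ((smul_eq_sum_left hη).trans
      (Finset.sum_eq_zero fun j _ => ?_))).resolve_left (hr r)
    rw [ih (map_interiorProduct_left_mem (onb V j) hη), map_zero]
    have : TensorProduct.map (sharpVolume V) (sharpVolume V)
        (TensorProduct.map (interiorProduct (onb V j)) LinearMap.id η) =
        TensorProduct.map
          (LinearMap.mulLeft ℝ (ExteriorAlgebra.ι ℝ (coframe V j))) LinearMap.id
          (TensorProduct.map (sharpVolume V) (sharpVolume V) η) := by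
      simp only [← LinearMap.comp_apply, ← TensorProduct.map_comp]
      congr 2
      exact LinearMap.ext fun θ => ι_mul_sharpVolume j θ
    rw [this, h, map_zero]

/-- The Hodge star is injective on double forms of a given bidegree. -/
theorem eq_zero_of_hodge_eq_zero {r s : ℕ} {η : DoubleForms V} (hη : η ∈ bidegree V r s)
    (h : hodge η = 0) : η = 0 := by
  have h1 : TensorProduct.map (sharpVolume V) (sharpVolume V)
      (TensorProduct.map reverseForm reverseForm η) = 0 := by
    rw [← h, ← LinearMap.comp_apply, ← TensorProduct.map_comp]
    rfl
  have h2 := map_sharpVolume_eq_zero (bidegree_le_comap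
    (f := TensorProduct.map reverseForm reverseForm) (fun _ hθ _ hθ' =>
      tmul_mem_bidegree (reverseForm_mem hθ) (reverseForm_mem hθ')) hη) h1
  have h3 := congrArg (TensorProduct.map reverseForm reverseForm) h2
  rw [map_zero, ← LinearMap.comp_apply, ← TensorProduct.map_comp] at h3
  have h4 : (reverseForm ∘ₗ reverseForm : Forms V →ₗ[ℝ] Forms V) = LinearMap.id :=
    LinearMap.ext reverseForm_reverseForm
  rwa [h4, TensorProduct.map_id, LinearMap.id_apply] at h3

/-- The action of a decomposable form is a succession of interior products by vectors, each
preserving decomposability. With the volume form for α, this makes the star preserve squares. -/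
theorem IsDecomposable.sharpAction_reverseForm {r m : ℕ} {θ α : Forms V} (h : IsDecomposable r θ)
    (hα : IsDecomposable (m + r) α) : IsDecomposable m (sharpAction V (reverseForm θ) α) := by
  induction r generalizing θ α with
  | zero =>
    obtain ⟨t, rfl⟩ := h
    rw [map_smul, map_smul, reverseForm_one, map_one (sharpAction V)]
    exact hα.smul t
  | succ r ih =>
    obtain ⟨φ, θ', h', rfl⟩ := h
    rw [reverseForm_mul, reverseForm_ι, map_mul, sharpAction_ι, Module.End.mul_apply,
      interiorSharp_apply]
    exact ih h' (IsDecomposable.interiorProduct (r := m + r) hα _)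

theorem hodge_mem_decomposableSquares {r m : ℕ} (hr : m + r = finrank ℝ V) {η : DoubleForms V}
    (hη : η ∈ decomposableSquares V r) : hodge η ∈ decomposableSquares V m := by
  have : decomposableSquares V r ≤ (decomposableSquares V m).comap hodge := by
    refine Submodule.span_le.2 ?_
    rintro _ ⟨θ, hθ, rfl⟩
    exact tmul_self_mem_decomposableSquares (hθ.sharpAction_reverseForm
      (hr ▸ IsDecomposable.ιMulti (coframe V)))
  exact this hη

end Hodge

/-! ### Algebraic curvature tensors -/

section AlgebraicCurvature

variable {V : Type*} [NormedAddCommGroup V] [InnerProductSpace ℝ V]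

/-- The double form `(a ∧ b) ⊗ (c ∧ d)`. -/
def wedgeTensor (a b c d : Dual ℝ V) : DoubleForms V :=
  (ExteriorAlgebra.ι ℝ a * ExteriorAlgebra.ι ℝ b) ⊗ₜ[ℝ]
    (ExteriorAlgebra.ι ℝ c * ExteriorAlgebra.ι ℝ d)

theorem wedgeTensor_swap_right (a b c d : Dual ℝ V) :
    wedgeTensor a b d c = -wedgeTensor a b c d := by
  rw [wedgeTensor, eq_neg_of_add_eq_zero_left (ExteriorAlgebra.ι_add_mul_swap d c),
    TensorProduct.tmul_neg, wedgeTensor]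

theorem wedgeTensor_swap_left (a b c d : Dual ℝ V) :
    wedgeTensor b a c d = -wedgeTensor a b c d := by
  rw [wedgeTensor, eq_neg_of_add_eq_zero_left (ExteriorAlgebra.ι_add_mul_swap b a),
    TensorProduct.neg_tmul, wedgeTensor]

theorem wedgeTensor_self_mem (a b : Dual ℝ V) :
    wedgeTensor a b a b ∈ decomposableSquares V 2 :=
  tmul_self_mem_decomposableSquares ((IsDecomposable.ι a).mul (IsDecomposable.ι b))

/-- Modulo squares of decomposable forms, the symmetrization of `(a ∧ b) ⊗ (c ∧ d)` is invariant
under cyclic permutations of `b, c, d`. -/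
theorem wedgeTensor_cyclic_mem (a b c d : Dual ℝ V) :
    (wedgeTensor a b c d + wedgeTensor c d a b) - (wedgeTensor a d b c + wedgeTensor b c a d) ∈
      decomposableSquares V 2 := by
  have h1 : ∀ a b c : Dual ℝ V, wedgeTensor a b c b + wedgeTensor c b a b ∈
      decomposableSquares V 2 := fun a b c => by
    -- Polarization of (a ∧ b) ⊗ (a ∧ b) in a.
    have := sub_mem (sub_mem (wedgeTensor_self_mem (a + c) b) (wedgeTensor_self_mem a b))
      (wedgeTensor_self_mem c b)
    convert this using 1
    simp only [wedgeTensor, map_add, add_mul, TensorProduct.add_tmul, TensorProduct.tmul_add]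
    abel
  -- Polarization in the repeated covector b as well.
  have h2 := sub_mem (sub_mem (h1 a (b + d) c) (h1 a b c)) (h1 a d c)
  convert h2 using 1
  rw [show wedgeTensor a d b c = -wedgeTensor a d c b from wedgeTensor_swap_right a d c b,
    show wedgeTensor b c a d = -wedgeTensor c b a d from wedgeTensor_swap_left c b a d]
  simp only [wedgeTensor, map_add, mul_add, TensorProduct.add_tmul, TensorProduct.tmul_add]
  abel

/-- The classical octahedron argument: add the Bianchi identities at four cyclic shifts of the
indices and cancel by antisymmetry. -/
theorem pair_symm_of_bianchi {I : Type*} {R : I → I → I → I → ℝ}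
    (h1 : ∀ i j k l, R j i k l = -R i j k l) (h2 : ∀ i j k l, R i j l k = -R i j k l)
    (h3 : ∀ i j k l, R i j k l + R j k i l + R k i j l = 0) (i j k l : I) :
    R k l i j = R i j k l := by
  linarith [h3 i j k l, h3 j k l i, h3 k l i j, h3 l i j k, h1 i j k l, h1 k l i j, h2 i j k l,
    h2 k l i j, h1 i k j l, h2 i k j l, h1 i l j k, h2 i l j k, h1 j k i l, h2 j k i l,
    h1 j l i k, h2 j l i k, h2 k i j l, h2 k j i l, h2 l i j k, h2 l j i k, h2 l k i j, h2 j i k l]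

theorem sum_rotate {I M : Type*} [Fintype I] [AddCommMonoid M] (f : I → I → I → M) :
    ∑ j, ∑ k, ∑ l, f j k l = ∑ j, ∑ k, ∑ l, f l j k := by
  rw [Finset.sum_congr rfl fun j _ => Finset.sum_comm (f := fun k l => f l j k), Finset.sum_comm]

theorem sum_swap_pairs {I M : Type*} [Fintype I] [AddCommMonoid M] (f : I → I → I → I → M) :
    ∑ i, ∑ j, ∑ k, ∑ l, f i j k l = ∑ i, ∑ j, ∑ k, ∑ l, f k l i j := by
  have h := Finset.sum_comm (s := Finset.univ) (t := Finset.univ)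
    (f := fun x y : I × I => f x.1 x.2 y.1 y.2)
  simpa only [Fintype.sum_prod_type] using h

/-- A tensor with the symmetries of a Riemann curvature tensor is a linear combination of squares
of decomposable 2-forms. -/
theorem curvature_mem_decomposableSquares {I : Type*} [Fintype I] {R : I → I → I → I → ℝ}
    (h1 : ∀ i j k l, R j i k l = -R i j k l) (h2 : ∀ i j k l, R i j l k = -R i j k l)
    (h3 : ∀ i j k l, R i j k l + R j k i l + R k i j l = 0) (φ : I → Dual ℝ V) :
    ∑ i, ∑ j, ∑ k, ∑ l, R i j k l • wedgeTensor (φ i) (φ j) (φ k) (φ l) ∈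
      decomposableSquares V 2 := by
  set W := decomposableSquares V 2
  let F : I → I → I → I → DoubleForms V := fun i j k l =>
    wedgeTensor (φ i) (φ j) (φ k) (φ l) + wedgeTensor (φ k) (φ l) (φ i) (φ j)
  have hsymm := pair_symm_of_bianchi h1 h2 h3
  -- Pair symmetry turns the Bianchi identity in the first three indices into one in the last three,
  -- the indices permuted in F.
  have hcyc : ∀ i j k l, R i j k l + R i l j k + R i k l j = 0 := fun i j k l => by
    rw [← hsymm, ← hsymm i l, ← hsymm i k, h2 k l j i, h2 j k l i, h2 l j k i]
    linarith [h3 j k l i]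
  have hF : ∀ i j k l, F i j k l - F i l j k ∈ W := fun i j k l =>
    wedgeTensor_cyclic_mem (φ i) (φ j) (φ k) (φ l)
  set S := ∑ i, ∑ j, ∑ k, ∑ l, R i j k l • F i j k l with hS
  set S' := ∑ i, ∑ j, ∑ k, ∑ l, R i l j k • F i j k l with hS'
  set S'' := ∑ i, ∑ j, ∑ k, ∑ l, R i k l j • F i j k l with hS''
  -- Reindexing S lets both sums carry the same coefficients, so their difference only involves F i
  -- j k l - F i l j k.
  have e1 : S' - S ∈ W := by
    have : S = ∑ i, ∑ j, ∑ k, ∑ l, R i l j k • F i l j k :=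
      Finset.sum_congr rfl fun i _ => sum_rotate fun j k l => R i j k l • F i j k l
    rw [this, hS']
    simp only [← Finset.sum_sub_distrib, ← smul_sub]
    exact sum_mem fun i _ => sum_mem fun j _ => sum_mem fun k _ => sum_mem fun l _ =>
      W.smul_mem _ (hF i j k l)
  have e2 : S'' - S' ∈ W := by
    have : S' = ∑ i, ∑ j, ∑ k, ∑ l, R i k l j • F i l j k :=
      Finset.sum_congr rfl fun i _ => sum_rotate fun j k l => R i l j k • F i j k l
    rw [this, hS'']
    simp only [← Finset.sum_sub_distrib, ← smul_sub]
    exact sum_mem fun i _ => sum_mem fun j _ => sum_mem fun k _ => sum_mem fun l _ =>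
      W.smul_mem _ (hF i j k l)
  have e3 : S + S' + S'' = 0 := by
    simp only [hS, hS', hS'', ← Finset.sum_add_distrib, ← add_smul]
    refine Finset.sum_eq_zero fun i _ => Finset.sum_eq_zero fun j _ => Finset.sum_eq_zero
      fun k _ => Finset.sum_eq_zero fun l _ => ?_
    rw [hcyc, zero_smul]
  have hS0 : S ∈ W := by
    -- Modulo W the three sums agree, and they add up to zero, so 3S lies in W.
    have h3S : (3 : ℝ) • S = -((S' - S) + (S' - S) + (S'' - S')) := by
      have : S = -S' - S'' := by rw [eq_sub_iff_add_eq, eq_neg_iff_add_eq_zero, ← e3]; abel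
      rw [show (3 : ℝ) • S = S + S + S by module]
      nth_rewrite 1 [this]
      abel
    have : S = (3 : ℝ)⁻¹ • (3 : ℝ) • S := by rw [smul_smul]; norm_num
    rw [this, h3S]
    exact W.smul_mem _ (neg_mem (add_mem (add_mem e1 e1) e2))
  have hdouble : S = (2 : ℝ) • ∑ i, ∑ j, ∑ k, ∑ l,
      R i j k l • wedgeTensor (φ i) (φ j) (φ k) (φ l) := by
    simp only [hS, F, smul_add, Finset.sum_add_distrib]
    rw [two_smul, sum_swap_pairs fun i j k l =>
      R i j k l • wedgeTensor (φ k) (φ l) (φ i) (φ j)]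
    simp only [hsymm]
  have : ∑ i, ∑ j, ∑ k, ∑ l, R i j k l • wedgeTensor (φ i) (φ j) (φ k) (φ l) =
      (2 : ℝ)⁻¹ • S := by rw [hdouble, smul_smul]; norm_num
  rw [this]
  exact W.smul_mem _ hS0

end AlgebraicCurvature

/-! ### The theorem at a point -/

section Pointwise

variable {V : Type*} [NormedAddCommGroup V] [InnerProductSpace ℝ V] [FiniteDimensional ℝ V]
  {R : DoubleForms V} {p q : ℕ}

theorem pqCurvatureTensor_mem (hR : R ∈ decomposableSquares V 2) (h : p + 2 * q ≤ finrank ℝ V) :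
    pqCurvatureTensor R p q ∈ decomposableSquares V p := by
  refine Submodule.smul_mem _ _ (hodge_mem_decomposableSquares
    (r := finrank ℝ V - 2 * q - p + 2 * q) (by omega) ?_)
  exact mul_mem_decomposableSquares (metricForm_pow_mem_decomposableSquares _)
    (pow_mem_decomposableSquares hR q)

/-- The `(p, q)`-curvature is constant if and only if `R^q` is a multiple of `g^{2q}` up to the
kernel of the multiplication by `g^{n-2q-p}`. -/
theorem hasConstant_pqCurvature_iff (hR : R ∈ decomposableSquares V 2)
    (h : p + 2 * q ≤ finrank ℝ V) (a : ℝ) :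
    HasConstantSectionalCurvature p (pqCurvatureTensor R p q) a ↔
      (metricMul V ^ (finrank ℝ V - 2 * q - p)) (R ^ q -
        (a * (finrank ℝ V - p - 2 * q).factorial / (finrank ℝ V - p).factorial) •
          metricForm V ^ (2 * q)) = 0 := by
  have hf : ∀ k : ℕ, (k.factorial : ℝ) ≠ 0 := fun k => by exact_mod_cast k.factorial_ne_zero
  obtain ⟨k, hk⟩ := Nat.exists_eq_add_of_le h
  have e1 : finrank ℝ V - 2 * q - p = k := by omega
  have e2 : finrank ℝ V - p - 2 * q = k := by omega
  have e3 : finrank ℝ V - p = k + 2 * q := by omega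
  have e4 : finrank ℝ V - (k + 2 * q) = p := by omega
  rw [hasConstantSectionalCurvature_iff (pqCurvatureTensor_mem hR h), pqCurvatureTensor, e1, e2,
    e3, map_sub, map_smul, metricMul_pow_apply, metricMul_pow_apply, ← pow_add]
  have hmem : metricForm V ^ k * R ^ q - (a * k.factorial / (k + 2 * q).factorial : ℝ) •
      metricForm V ^ (k + 2 * q) ∈ bidegree V (k + 2 * q) (k + 2 * q) :=
    decomposableSquares_le_bidegree _ (sub_mem (mul_mem_decomposableSquares
      (metricForm_pow_mem_decomposableSquares _) (pow_mem_decomposableSquares hR q))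
      (Submodule.smul_mem _ _ (metricForm_pow_mem_decomposableSquares _)))
  -- With n = k + 2q + p, *g^(k+2q) is (k+2q)!/p! times g^p; this is where the constant a k!/(k+2q)!
  -- comes from.
  have hh : hodge (metricForm V ^ k * R ^ q - (a * k.factorial / (k + 2 * q).factorial : ℝ) •
      metricForm V ^ (k + 2 * q)) = (k.factorial : ℝ) • ((k.factorial : ℝ)⁻¹ •
        hodge (metricForm V ^ k * R ^ q) - (a / p.factorial) • metricForm V ^ p) := by
    rw [map_sub, map_smul, hodge_metricForm_pow (by omega), e4, smul_sub, smul_smul, smul_smul,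
      smul_smul, mul_inv_cancel₀ (hf k), one_smul]
    congr 2
    field_simp [hf k, hf p, hf (k + 2 * q)]
  constructor
  · intro H
    refine eq_zero_of_hodge_eq_zero hmem ?_
    rw [hh, H, sub_self, smul_zero]
  · intro H
    rw [H, map_zero, eq_comm, smul_eq_zero] at hh
    exact sub_eq_zero.1 (hh.resolve_left (hf k))

theorem pow_sub_mem_bidegree (hR : R ∈ decomposableSquares V 2) (t : ℝ) :
    R ^ q - t • metricForm V ^ (2 * q) ∈ bidegree V (2 * q) (2 * q) :=
  decomposableSquares_le_bidegree _ (sub_mem (pow_mem_decomposableSquares hR q)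
    (Submodule.smul_mem _ _ (metricForm_pow_mem_decomposableSquares _)))

/-- The difference of R^q and the multiple of g^(2q) has weight n - 4q, and 2q ≤ p gives n - 2q - p
≤ n - 4q: multiplication by this power of g is injective there. -/
theorem hasConstant_pqCurvature_iff_of_two_mul_le (hR : R ∈ decomposableSquares V 2)
    (hp : 2 * q ≤ p) (h : p + 2 * q ≤ finrank ℝ V) (a : ℝ) :
    HasConstantSectionalCurvature p (pqCurvatureTensor R p q) a ↔
      HasConstantSectionalCurvature (2 * q) (R ^ q)
        (a * (2 * q).factorial * (finrank ℝ V - p - 2 * q).factorial /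
          (finrank ℝ V - p).factorial) := by
  have hf : ((2 * q).factorial : ℝ) ≠ 0 := by exact_mod_cast Nat.factorial_ne_zero _
  rw [hasConstant_pqCurvature_iff hR h,
    hasConstantSectionalCurvature_iff (pow_mem_decomposableSquares hR q), ← sub_eq_zero (a := R ^ q),
    show a * (2 * q).factorial * (finrank ℝ V - p - 2 * q).factorial /
      (finrank ℝ V - p).factorial / (2 * q).factorial =
      a * (finrank ℝ V - p - 2 * q).factorial / (finrank ℝ V - p).factorial by field_simp]
  obtain ⟨m, hm⟩ := contraction_nilpotent V
  refine ⟨(slTwoRelations V).eq_zero_of_lower_pow_eq_zero (m := m) (by rw [hm, LinearMap.zero_apply])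
    (weightOp_of_mem (pow_sub_mem_bidegree hR _)) ?_, fun H => by rw [H, map_zero]⟩
  have : ((finrank ℝ V - 2 * q - p : ℕ) : ℝ) + 4 * q ≤ finrank ℝ V := by
    exact_mod_cast (by omega : finrank ℝ V - 2 * q - p + 4 * q ≤ finrank ℝ V)
  push_cast
  linarith

/-- The constant is chosen before the space, so that one factor serves all tangent spaces at once.
-/
theorem exists_contraction_pow_metricForm_pow (n k l : ℕ) (h : k + l ≤ n) :
    ∃ C : ℝ, C ≠ 0 ∧ ∀ (W : Type*) [NormedAddCommGroup W] [InnerProductSpace ℝ W]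
      [FiniteDimensional ℝ W], finrank ℝ W = n →
      (contraction ^ l) (metricForm W ^ (k + l)) = C • metricForm W ^ k := by
  induction l with
  | zero => exact ⟨1, one_ne_zero, fun W _ _ _ _ => by simp⟩
  | succ l ih =>
    obtain ⟨C, hC, hl⟩ := ih (by omega)
    have h' : ((k + l : ℕ) : ℝ) + 1 ≤ n := by exact_mod_cast h
    refine ⟨(((k + l : ℕ) : ℝ) + 1) * (n - (k + l : ℕ)) * C,
      mul_ne_zero (mul_ne_zero (by positivity) (by linarith)) hC, fun W _ _ _ hW => ?_⟩
    rw [← add_assoc, pow_succ, Module.End.mul_apply, contraction_metricForm_pow, map_smul, hl W hW,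
      smul_smul, hW]

/-- For `p < 2q` the `(p, q)`-curvature is constant if and only if `c^{2q-p} R^q` is a multiple of
`g^p`. The factor between the constants depends only on the dimension, `p` and `q`. -/
theorem exists_hasConstant_pqCurvature_iff_contraction {n : ℕ} (hp : p < 2 * q)
    (h : p + 2 * q ≤ n) : ∃ C : ℝ, C ≠ 0 ∧
      ∀ (W : Type*) [NormedAddCommGroup W] [InnerProductSpace ℝ W] [FiniteDimensional ℝ W],
        finrank ℝ W = n → ∀ R ∈ decomposableSquares W 2, ∀ a : ℝ,
          HasConstantSectionalCurvature p (pqCurvatureTensor R p q) a ↔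
            (contraction ^ (2 * q - p)) (R ^ q) = (a * C) • metricForm W ^ p := by
  obtain ⟨C, hC, hc⟩ := exists_contraction_pow_metricForm_pow n p (2 * q - p) (by omega)
  rw [show p + (2 * q - p) = 2 * q by omega] at hc
  have hf : ∀ k : ℕ, (k.factorial : ℝ) ≠ 0 := fun k => by exact_mod_cast k.factorial_ne_zero
  refine ⟨(n - p - 2 * q).factorial / (n - p).factorial * C,
    mul_ne_zero (div_ne_zero (hf _) (hf _)) hC, fun W _ _ _ hW R hR a => ?_⟩
  rw [hasConstant_pqCurvature_iff hR (by rw [hW]; exact h),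
    (slTwoRelations W).lower_pow_eq_zero_iff_raise_pow_eq_zero (contraction_nilpotent W)
      (metricMul_nilpotent W) (weightOp_of_mem (pow_sub_mem_bidegree hR _)) (l := 2 * q - p),
    map_sub, map_smul, hc W hW, smul_smul, sub_eq_zero, hW, ← mul_assoc, mul_div_assoc]
  -- The exponents differ by the weight: (n - 2q - p) - (2q - p) = n - 4q.
  have h1 : ((finrank ℝ W - 2 * q - p : ℕ) : ℝ) + 2 * q + p = finrank ℝ W := by
    rw [hW]
    exact_mod_cast (by omega : n - 2 * q - p + 2 * q + p = n)
  have h2 : ((2 * q - p : ℕ) : ℝ) + p = 2 * q := by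
    exact_mod_cast (by omega : 2 * q - p + p = 2 * q)
  push_cast
  linarith

/-- Contracting ζ yields ∑_{i≤p} C_i g^(p-i) η_i. A multiple of g^p only affects the term i = 0, so
the other terms must vanish: by uniqueness if i + p ≤ n, automatically otherwise. -/
theorem contraction_pow_eq_smul_metricForm_pow_iff {n : ℕ} (hn : finrank ℝ V = n) (hp : p < 2 * q)
    {ζ : DoubleForms V}
    {η : ℕ → DoubleForms V} (hη : ∀ i ≤ 2 * q, η i ∈ effective V i i)
    (hζ : ζ = ∑ i ∈ Finset.range (2 * q + 1), metricForm V ^ (2 * q - i) * η i)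
    (h0 : ∀ i ≤ p, n < i + 2 * q → η i = 0) :
    (∃ b : ℝ, (contraction ^ (2 * q - p)) ζ = b • metricForm V ^ p) ↔
      ∀ i, 1 ≤ i → i ≤ min p (n - p) → η i = 0 := by
  subst hn
  have hw : ∀ i ≤ 2 * q, weightOp V (η i) = ((finrank ℝ V : ℝ) - 2 * i) • η i := fun i hi =>
    weightOp_of_mem (hη i hi).1
  have hc : ∀ i ≤ 2 * q, contraction (η i) = 0 := fun i hi => (hη i hi).2
  obtain ⟨t, ht⟩ := exists_eq_smul_one (hη 0 (by omega)).1
  -- The scalar of `raise_pow_lower_pow` for c^(2q-p) acting on g^(2q-i) η_i, a vector of the string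
  -- of weight n - 2i. It is nonzero once i + 2q ≤ n; `h0` covers the other indices.
  let C : ℕ → ℝ := fun i => ∏ s ∈ Finset.range (2 * q - p),
    (((p - i : ℕ) + s + 1 : ℝ) * (finrank ℝ V - 2 * i - (p - i : ℕ) - s))
  have hC : ∀ i ≤ p, i + 2 * q ≤ finrank ℝ V → C i ≠ 0 := fun i hi hn =>
    Finset.prod_ne_zero_iff.2 fun s hs => by
      have hs' := Finset.mem_range.1 hs
      have h1 : ((p - i : ℕ) : ℝ) + i = p := by exact_mod_cast (by omega : p - i + i = p)
      have h2 : (i + p + s + 1 : ℝ) ≤ finrank ℝ V := by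
        exact_mod_cast (by omega : i + p + s + 1 ≤ finrank ℝ V)
      exact mul_ne_zero (by positivity) (by linarith)
  have hsum : (contraction ^ (2 * q - p)) ζ =
      ∑ i ∈ Finset.range (p + 1), (metricMul V ^ (p - i)) (C i • η i) := by
    rw [hζ, map_sum, ← Finset.sum_subset (Finset.range_subset_range.2 (by omega : p + 1 ≤ 2 * q + 1))]
    · refine Finset.sum_congr rfl fun i hi => ?_
      have hi' : i ≤ p := by simpa [Nat.lt_succ_iff] using hi
      have := (slTwoRelations V).raise_pow_lower_pow (hw i (by omega)) (hc i (by omega)) (p - i)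
        (2 * q - p)
      rw [show p - i + (2 * q - p) = 2 * q - i by omega, metricMul_pow_apply] at this
      rw [this, map_smul]
    · intro i hi hi'
      have hi1 : i ≤ 2 * q := by simpa [Nat.lt_succ_iff] using hi
      have hi2 : p < i := by simpa [Nat.lt_succ_iff] using hi'
      rw [← metricMul_pow_apply]
      exact (slTwoRelations V).raise_pow_lower_pow_eq_zero (hw i hi1) (hc i hi1) (by omega)
  rw [hsum]
  constructor
  · rintro ⟨b, hb⟩ i hi1 hi2
    have hip : i ≤ p := hi2.trans (min_le_left _ _)
    -- Truncation of n - p is harmless: 1 ≤ i ≤ n - p forces p < n.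
    have hin : i + p ≤ finrank ℝ V := by
      have := hi2.trans (min_le_right _ _)
      omega
    by_cases hn : finrank ℝ V < i + 2 * q
    · exact h0 i hip hn
    -- The multiple b g^p is absorbed into the effective component of degree zero.
    let y : ℕ → DoubleForms V := fun i => C i • η i - if i = 0 then b • 1 else 0
    have hy : ∀ i ≤ p, y i ∈ effective V i i := fun i hi => by
      refine sub_mem (Submodule.smul_mem _ _ (hη i (by omega))) ?_
      split_ifs with h
      · subst h
        exact Submodule.smul_mem _ _ one_mem_effective
      · exact zero_mem _
    have hyi : y i = 0 := by
      refine (slTwoRelations V).eq_zero_of_sum_lower_pow_eq_zero (d := finrank ℝ V) (p := p) (y := y)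
        (fun j hj => weightOp_of_mem (hy j hj).1) (fun j hj => (hy j hj).2) ?_ hip
        (by exact_mod_cast hin)
      simp only [y, map_sub, Finset.sum_sub_distrib, hb]
      rw [Finset.sum_eq_single_of_mem 0 (by simp) fun j _ hj => by rw [if_neg hj, map_zero],
        if_pos rfl, map_smul, metricMul_pow_apply, mul_one, Nat.sub_zero, sub_self]
    simp only [y, if_neg (by omega : ¬ i = 0), sub_zero] at hyi
    exact (smul_eq_zero.1 hyi).resolve_left (hC i hip (by omega))
  · intro H
    refine ⟨C 0 * t, ?_⟩
    rw [Finset.sum_eq_single_of_mem 0 (by simp), ht, smul_smul, map_smul, metricMul_pow_apply,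
      mul_one, Nat.sub_zero]
    intro i hi hi0
    have hip : i ≤ p := by simpa [Nat.lt_succ_iff] using hi
    rw [map_smul]
    by_cases hin : i ≤ finrank ℝ V - p
    · rw [H i (by omega) (le_min hip hin), map_zero, smul_zero]
    -- Here i + p ≥ n + 1, so the exponent p - i exceeds the weight n - 2i and the term is past the
    -- end of its string.
    · rw [(slTwoRelations V).lower_pow_eq_zero_of_weight_lt (metricMul_nilpotent V) (hw i (by omega))
        (hc i (by omega)), smul_zero]
      have h1 : ((p - i : ℕ) : ℝ) + i = p := by exact_mod_cast (by omega : p - i + i = p)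
      have h2 : (finrank ℝ V : ℝ) + 1 ≤ i + p := by
        exact_mod_cast (by omega : finrank ℝ V + 1 ≤ i + p)
      linarith

end Pointwise

/-! ### Symmetries of the Riemann curvature tensor -/

section PartialDerivatives

variable {n : ℕ} {y : EuclideanSpace ℝ (Fin n)}

theorem partialDeriv_add {f h : EuclideanSpace ℝ (Fin n) → ℝ} (hf : DifferentiableAt ℝ f y)
    (hh : DifferentiableAt ℝ h y) (i : Fin n) :
    partialDeriv i (fun z => f z + h z) y = partialDeriv i f y + partialDeriv i h y := by
  rw [partialDeriv, fderiv_fun_add hf hh]; rfl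

theorem partialDeriv_sub {f h : EuclideanSpace ℝ (Fin n) → ℝ} (hf : DifferentiableAt ℝ f y)
    (hh : DifferentiableAt ℝ h y) (i : Fin n) :
    partialDeriv i (fun z => f z - h z) y = partialDeriv i f y - partialDeriv i h y := by
  rw [partialDeriv, fderiv_fun_sub hf hh]; rfl

theorem partialDeriv_const_mul {f : EuclideanSpace ℝ (Fin n) → ℝ} (hf : DifferentiableAt ℝ f y)
    (t : ℝ) (i : Fin n) :
    partialDeriv i (fun z => t * f z) y = t * partialDeriv i f y := by
  rw [partialDeriv, fderiv_const_mul hf]; rfl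

theorem partialDeriv_mul {f h : EuclideanSpace ℝ (Fin n) → ℝ} (hf : DifferentiableAt ℝ f y)
    (hh : DifferentiableAt ℝ h y) (i : Fin n) :
    partialDeriv i (fun z => f z * h z) y = f y * partialDeriv i h y + partialDeriv i f y * h y := by
  rw [partialDeriv, fderiv_fun_mul hf hh]
  simp [partialDeriv, mul_comm]

theorem partialDeriv_sum {J : Type*} [Fintype J] {f : J → EuclideanSpace ℝ (Fin n) → ℝ}
    (hf : ∀ j, DifferentiableAt ℝ (f j) y) (i : Fin n) :
    partialDeriv i (fun z => ∑ j, f j z) y = ∑ j, partialDeriv i (f j) y := by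
  rw [partialDeriv, fderiv_fun_sum fun j _ => hf j, _root_.sum_apply]; rfl

theorem differentiableAt_partialDeriv {f : EuclideanSpace ℝ (Fin n) → ℝ}
    (hf : ContDiffAt ℝ 2 f y) (i : Fin n) : DifferentiableAt ℝ (partialDeriv i f) y :=
  ((hf.fderiv_right (m := 1) le_rfl).differentiableAt one_ne_zero).clm_apply
    (differentiableAt_const _)

theorem partialDeriv_comm {f : EuclideanSpace ℝ (Fin n) → ℝ} (hf : ContDiffAt ℝ 2 f y)
    (i j : Fin n) : partialDeriv i (partialDeriv j f) y = partialDeriv j (partialDeriv i f) y := by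
  have hd : DifferentiableAt ℝ (fderiv ℝ f) y :=
    (hf.fderiv_right (m := 1) le_rfl).differentiableAt one_ne_zero
  have h : ∀ i j : Fin n, partialDeriv i (partialDeriv j f) y =
      fderiv ℝ (fderiv ℝ f) y (EuclideanSpace.single i 1) (EuclideanSpace.single j 1) := by
    intro i j
    change fderiv ℝ (fun z => fderiv ℝ f z (EuclideanSpace.single j 1)) y _ = _
    rw [fderiv_clm_apply hd (differentiableAt_const _)]
    simp
  rw [h, h]
  exact (hf.isSymmSndFDerivAt (by simp)).eq _ _

theorem differentiableAt_det {J : Type*} [Fintype J] [DecidableEq J]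
    {A : EuclideanSpace ℝ (Fin n) → Matrix J J ℝ}
    (hA : ∀ i j, DifferentiableAt ℝ (fun z => A z i j) y) :
    DifferentiableAt ℝ (fun z => (A z).det) y := by
  simp only [Matrix.det_apply']
  exact DifferentiableAt.fun_sum fun σ _ => (HasFDerivAt.finsetProd fun i _ =>
    (hA _ _).hasFDerivAt).differentiableAt.const_mul _

/-- By the cofactor formula the entries are quotients of determinants, the adjugate ones having a
row replaced by a constant vector. -/
theorem differentiableAt_inv_apply {J : Type*} [Fintype J] [DecidableEq J]
    {A : EuclideanSpace ℝ (Fin n) → Matrix J J ℝ}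
    (hA : ∀ i j, DifferentiableAt ℝ (fun z => A z i j) y) (hdet : (A y).det ≠ 0) (k l : J) :
    DifferentiableAt ℝ (fun z => (A z)⁻¹ k l) y := by
  simp only [Matrix.inv_def, Matrix.smul_apply, Ring.inverse_eq_inv', smul_eq_mul,
    Matrix.adjugate_apply]
  refine ((differentiableAt_det hA).inv hdet).mul (differentiableAt_det fun i j => ?_)
  by_cases hi : i = l
  · subst hi; simp
  · simpa [Matrix.updateRow_ne hi] using hA i j

end PartialDerivatives

/-! ### Christoffel symbols and the symmetries of the curvature components -/

section CurvatureSymmetries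

theorem det_gram_ne_zero {E J : Type*} [NormedAddCommGroup E] [InnerProductSpace ℝ E] [Fintype J]
    [DecidableEq J] {v : J → E} (h : LinearIndependent ℝ v) :
    (Matrix.of fun i j => inner ℝ (v i) (v j)).det ≠ 0 :=
  (Matrix.posDef_gram_of_linearIndependent (𝕜 := ℝ) h).det_pos.ne'

variable {n : ℕ} {M : Type*} [TopologicalSpace M] [ChartedSpace (EuclideanSpace ℝ (Fin n)) M]

theorem contMDiffOn_coordVector [IsManifold (𝓡 n) ∞ M] (m : M) (i : Fin n) :
    ContMDiffOn 𝓘(ℝ, EuclideanSpace ℝ (Fin n)) (𝓡 n).tangent ∞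
      (fun y => (⟨(extChartAt (𝓡 n) m).symm y, coordVector m y i⟩ : TangentBundle (𝓡 n) M))
      (extChartAt (𝓡 n) m).target := by
  have ho : IsOpen (extChartAt (𝓡 n) m).target := isOpen_extChartAt_target m
  have h1 := (contMDiffOn_extChartAt_symm (I := 𝓡 n) (n := ∞) m).contMDiffOn_tangentMapWithin
    (m := ∞) (by simp) ho.uniqueMDiffOn
  have h2 : ContMDiff 𝓘(ℝ, EuclideanSpace ℝ (Fin n))
      (𝓘(ℝ, EuclideanSpace ℝ (Fin n))).tangent ∞
      (fun y => (⟨y, (EuclideanSpace.single i 1 : EuclideanSpace ℝ (Fin n))⟩ :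
        TangentBundle 𝓘(ℝ, EuclideanSpace ℝ (Fin n)) (EuclideanSpace ℝ (Fin n)))) := fun y =>
    contMDiffAt_vectorSpace_iff_contDiffAt.2 contDiffAt_const
  refine (h1.comp h2.contMDiffOn fun y hy => hy).congr fun y hy => ?_
  simp only [Function.comp_apply, tangentMapWithin, coordVector, mfderivWithin_of_isOpen ho hy]

theorem linearIndependent_coordVector [IsManifold (𝓡 n) ∞ M] (m : M) {y : EuclideanSpace ℝ (Fin n)}
    (hy : y ∈ (extChartAt (𝓡 n) m).target) : LinearIndependent ℝ (coordVector m y) := by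
  obtain ⟨L, hL⟩ := isInvertible_mfderivWithin_extChartAt_symm (I := 𝓡 n) hy
  have hL' : ∀ i, coordVector m y i = L (EuclideanSpace.single i 1) := fun i => by
    rw [coordVector, ← mfderivWithin_univ, ← ModelWithCorners.range_eq_univ (𝓡 n), ← hL]
    rfl
  have := (EuclideanSpace.basisFun (Fin n) ℝ).toBasis.linearIndependent.map'
    L.toLinearEquiv.toLinearMap L.toLinearEquiv.ker
  have hc : coordVector m y =
      L.toLinearEquiv.toLinearMap ∘ (EuclideanSpace.basisFun (Fin n) ℝ).toBasis := by
    funext i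
    rw [hL']
    have hb : (EuclideanSpace.single i 1 : EuclideanSpace ℝ (Fin n)) =
        (EuclideanSpace.basisFun (Fin n) ℝ).toBasis i := by simp
    exact congrArg L hb
  rw [hc]
  exact this

variable [RiemannianBundle (fun x : M => TangentSpace (𝓡 n) x)]

theorem metricMatrix_symm (m : M) (y : EuclideanSpace ℝ (Fin n)) (i j : Fin n) :
    metricMatrix m y i j = metricMatrix m y j i := by
  rw [metricMatrix, Matrix.of_apply, Matrix.of_apply]
  exact real_inner_comm _ _

theorem christoffelSymbol_symm (m : M) (k i j : Fin n) :
    christoffelSymbol m k i j = christoffelSymbol m k j i := by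
  funext y
  simp only [christoffelSymbol, metricMatrix_symm m _ i j]
  congr 1
  exact Finset.sum_congr rfl fun l _ => by ring

/-- The Christoffel symbols of the first kind `½ (∂_i g_{jl} + ∂_j g_{il} - ∂_l g_{ij})`. -/
def christoffelLower (m : M) (l i j : Fin n) (y : EuclideanSpace ℝ (Fin n)) : ℝ :=
  (1 / 2) * (partialDeriv i (fun z => metricMatrix m z j l) y
    + partialDeriv j (fun z => metricMatrix m z i l) y
    - partialDeriv l (fun z => metricMatrix m z i j) y)

theorem christoffelSymbol_eq_sum (m : M) (k i j : Fin n) (y : EuclideanSpace ℝ (Fin n)) :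
    christoffelSymbol m k i j y =
      ∑ l, (metricMatrix m y)⁻¹ k l * christoffelLower m l i j y := by
  rw [christoffelSymbol, Finset.mul_sum]
  exact Finset.sum_congr rfl fun l _ => by rw [christoffelLower]; ring

/-- Compatibility of the Levi-Civita connection with the metric, in coordinates. -/
theorem partialDeriv_metricMatrix (m : M) (y : EuclideanSpace ℝ (Fin n)) (i k s : Fin n) :
    partialDeriv i (fun z => metricMatrix m z k s) y =
      christoffelLower m s i k y + christoffelLower m k i s y := by
  have hs : ∀ a b : Fin n, (fun z => metricMatrix m z a b) = fun z => metricMatrix m z b a :=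
    fun a b => funext fun z => metricMatrix_symm m z a b
  rw [christoffelLower, christoffelLower, hs s k, hs i s, hs i k]
  ring

theorem loweredCurvature_swap_left (m : M) (i j k l : Fin n) (y : EuclideanSpace ℝ (Fin n)) :
    loweredCurvature m j i k l y = -loweredCurvature m i j k l y := by
  rw [loweredCurvature, loweredCurvature, ← Finset.sum_neg_distrib]
  refine Finset.sum_congr rfl fun s _ => ?_
  rw [← mul_neg]
  congr 1
  simp only [curvatureComponent, Finset.sum_sub_distrib]
  ring

/-- The Bianchi identity follows from the symmetry of the Christoffel symbols in their lower
indices, that is from vanishing torsion. The third index, which is the lowered one, stays fixed. -/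
theorem loweredCurvature_cyclic (m : M) (i j k l : Fin n) (y : EuclideanSpace ℝ (Fin n)) :
    loweredCurvature m i j l k y + loweredCurvature m j k l i y +
      loweredCurvature m k i l j y = 0 := by
  simp only [loweredCurvature, ← Finset.sum_add_distrib, ← mul_add]
  refine Finset.sum_eq_zero fun s _ => mul_eq_zero_of_right _ ?_
  simp only [curvatureComponent, Finset.sum_sub_distrib]
  rw [christoffelSymbol_symm m s k j, christoffelSymbol_symm m s i k,
    christoffelSymbol_symm m s j i]
  simp only [christoffelSymbol_symm m _ k j, christoffelSymbol_symm m _ i k,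
    christoffelSymbol_symm m _ j i]
  ring

variable [IsManifold (𝓡 n) ∞ M]

theorem contDiffOn_metricMatrix
    [IsContMDiffRiemannianBundle (𝓡 n) ∞ (EuclideanSpace ℝ (Fin n))
      (fun x : M => TangentSpace (𝓡 n) x)] (m : M) (i j : Fin n) :
    ContDiffOn ℝ ∞ (fun y => metricMatrix m y i j) (extChartAt (𝓡 n) m).target :=
  contMDiffOn_iff_contDiffOn.1
    ((contMDiffOn_coordVector m i).inner_bundle (contMDiffOn_coordVector m j))

theorem det_metricMatrix_ne_zero (m : M) {y : EuclideanSpace ℝ (Fin n)}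
    (hy : y ∈ (extChartAt (𝓡 n) m).target) : (metricMatrix m y).det ≠ 0 := by
  have h : @LinearIndependent (Fin n) ℝ (TangentSpace (𝓡 n) ((extChartAt (𝓡 n) m).symm y))
      (coordVector m y) _ NormedAddCommGroup.toAddCommGroup.toAddCommMonoid
      InnerProductSpace.toNormedSpace.toModule := linearIndependent_coordVector m hy
  exact det_gram_ne_zero h

theorem sum_metricMatrix_mul_christoffelSymbol (m : M) {y : EuclideanSpace ℝ (Fin n)}
    (hy : y ∈ (extChartAt (𝓡 n) m).target) (k i j : Fin n) :
    ∑ s, metricMatrix m y k s * christoffelSymbol m s i j y = christoffelLower m k i j y := by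
  have h : metricMatrix m y * (metricMatrix m y)⁻¹ = 1 :=
    Matrix.mul_nonsing_inv _ (isUnit_iff_ne_zero.2 (det_metricMatrix_ne_zero m hy))
  have hv : (metricMatrix m y).mulVec ((metricMatrix m y)⁻¹.mulVec
      fun l => christoffelLower m l i j y) = fun l => christoffelLower m l i j y := by
    rw [Matrix.mulVec_mulVec, h, Matrix.one_mulVec]
  have := congrFun hv k
  simp only [Matrix.mulVec, dotProduct] at this
  simpa only [christoffelSymbol_eq_sum] using this

variable [IsContMDiffRiemannianBundle (𝓡 n) ∞ (EuclideanSpace ℝ (Fin n))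
  (fun x : M => TangentSpace (𝓡 n) x)]

theorem contDiffAt_metricMatrix (m : M) {y : EuclideanSpace ℝ (Fin n)}
    (hy : y ∈ (extChartAt (𝓡 n) m).target) (i j : Fin n) :
    ContDiffAt ℝ 2 (fun z => metricMatrix m z i j) y :=
  ((contDiffOn_metricMatrix m i j).contDiffAt
    ((isOpen_extChartAt_target m).mem_nhds hy)).of_le (WithTop.coe_le_coe.2 le_top)

theorem differentiableAt_christoffelLower (m : M) {y : EuclideanSpace ℝ (Fin n)}
    (hy : y ∈ (extChartAt (𝓡 n) m).target) (l i j : Fin n) :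
    DifferentiableAt ℝ (christoffelLower m l i j) y :=
  (((differentiableAt_partialDeriv (contDiffAt_metricMatrix m hy j l) i).add
    (differentiableAt_partialDeriv (contDiffAt_metricMatrix m hy i l) j)).sub
    (differentiableAt_partialDeriv (contDiffAt_metricMatrix m hy i j) l)).const_mul _

theorem differentiableAt_christoffelSymbol (m : M) {y : EuclideanSpace ℝ (Fin n)}
    (hy : y ∈ (extChartAt (𝓡 n) m).target) (k i j : Fin n) :
    DifferentiableAt ℝ (christoffelSymbol m k i j) y := by
  rw [funext (christoffelSymbol_eq_sum m k i j)]
  exact DifferentiableAt.fun_sum fun l _ => (differentiableAt_inv_apply (fun i j =>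
    (contDiffAt_metricMatrix m hy i j).differentiableAt two_ne_zero)
    (det_metricMatrix_ne_zero m hy) k l).mul (differentiableAt_christoffelLower m hy l i j)

theorem partialDeriv_christoffelLower (m : M) {y : EuclideanSpace ℝ (Fin n)}
    (hy : y ∈ (extChartAt (𝓡 n) m).target) (i l j k : Fin n) :
    partialDeriv i (christoffelLower m l j k) y =
      (1 / 2) * (partialDeriv i (partialDeriv j fun z => metricMatrix m z k l) y
        + partialDeriv i (partialDeriv k fun z => metricMatrix m z j l) y
        - partialDeriv i (partialDeriv l fun z => metricMatrix m z j k) y) := by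
  have h : ∀ a b c, DifferentiableAt ℝ (partialDeriv a fun z => metricMatrix m z b c) y :=
    fun a b c => differentiableAt_partialDeriv (contDiffAt_metricMatrix m hy b c) a
  change partialDeriv i (fun z => (1 / 2) * (partialDeriv j (fun z => metricMatrix m z k l) z
    + partialDeriv k (fun z => metricMatrix m z j l) z
    - partialDeriv l (fun z => metricMatrix m z j k) z)) y = _
  rw [partialDeriv_const_mul (((h j k l).fun_add (h k j l)).fun_sub (h l j k)),
    partialDeriv_sub ((h j k l).fun_add (h k j l)) (h l j k), partialDeriv_add (h j k l) (h k j l)]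

theorem sum_metricMatrix_mul_partialDeriv (m : M) {y : EuclideanSpace ℝ (Fin n)}
    (hy : y ∈ (extChartAt (𝓡 n) m).target) (i k j l : Fin n) :
    ∑ s, metricMatrix m y k s * partialDeriv i (christoffelSymbol m s j l) y =
      partialDeriv i (christoffelLower m k j l) y -
        ∑ s, partialDeriv i (fun z => metricMatrix m z k s) y * christoffelSymbol m s j l y := by
  have hG : ∀ s, DifferentiableAt ℝ (fun z => metricMatrix m z k s) y := fun s =>
    (contDiffAt_metricMatrix m hy k s).differentiableAt two_ne_zero
  have hΓ := fun s => differentiableAt_christoffelSymbol m hy s j l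
  -- Differentiating the index-lowering identity requires it near y, not just at y.
  have he : (fun z => ∑ s, metricMatrix m z k s * christoffelSymbol m s j l z) =ᶠ[nhds y]
      christoffelLower m k j l := by
    filter_upwards [(isOpen_extChartAt_target m).mem_nhds hy] with z hz
    exact sum_metricMatrix_mul_christoffelSymbol m hz k j l
  have h1 : partialDeriv i (fun z => ∑ s, metricMatrix m z k s * christoffelSymbol m s j l z) y =
      partialDeriv i (christoffelLower m k j l) y := by
    rw [partialDeriv, he.fderiv_eq, partialDeriv]
  rw [← h1, partialDeriv_sum fun s => (hG s).fun_mul (hΓ s),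
    Finset.sum_congr rfl fun s _ => partialDeriv_mul (hG s) (hΓ s) i, Finset.sum_add_distrib,
    add_sub_cancel_right]

/-- The lowered curvature in terms of the Christoffel symbols of the first kind. -/
theorem loweredCurvature_eq (m : M) {y : EuclideanSpace ℝ (Fin n)}
    (hy : y ∈ (extChartAt (𝓡 n) m).target) (i j k l : Fin n) :
    loweredCurvature m i j k l y =
      partialDeriv i (christoffelLower m k j l) y - partialDeriv j (christoffelLower m k i l) y
      - ∑ s, christoffelLower m s i k y * christoffelSymbol m s j l y
      + ∑ s, christoffelLower m s j k y * christoffelSymbol m s i l y := by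
  have h1 := sum_metricMatrix_mul_partialDeriv m hy i k j l
  have h2 := sum_metricMatrix_mul_partialDeriv m hy j k i l
  have h3 : ∀ a b : Fin n, ∑ s, metricMatrix m y k s *
      ∑ t, christoffelSymbol m s a t y * christoffelSymbol m t b l y =
      ∑ t, christoffelLower m k a t y * christoffelSymbol m t b l y := fun a b => by
    simp only [Finset.mul_sum, ← mul_assoc]
    rw [Finset.sum_comm]
    exact Finset.sum_congr rfl fun t _ => by
      rw [← Finset.sum_mul, sum_metricMatrix_mul_christoffelSymbol m hy]
  -- Of the two terms of ∂g, one cancels the quadratic part of the curvature and the other replaces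
  -- it.
  simp only [loweredCurvature, curvatureComponent, Finset.sum_sub_distrib, mul_add, mul_sub,
    Finset.sum_add_distrib, h1, h2, h3, partialDeriv_metricMatrix, add_mul]
  ring

/-- The quadratic terms are exchanged because the pairing of Christoffel symbols is symmetric; in
the second derivatives of the metric, the terms ∂_i ∂_j g_kl cancel by equality of mixed partials,
and the rest is antisymmetric. -/
theorem loweredCurvature_swap_right (m : M) {y : EuclideanSpace ℝ (Fin n)}
    (hy : y ∈ (extChartAt (𝓡 n) m).target) (i j k l : Fin n) :
    loweredCurvature m i j l k y = -loweredCurvature m i j k l y := by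
  have hquad : ∀ a b c d : Fin n, ∑ s, christoffelLower m s a b y * christoffelSymbol m s c d y =
      ∑ s, christoffelLower m s c d y * christoffelSymbol m s a b y := fun a b c d => by
    simp only [← sum_metricMatrix_mul_christoffelSymbol m hy, Finset.sum_mul]
    rw [Finset.sum_comm]
    exact Finset.sum_congr rfl fun s _ => Finset.sum_congr rfl fun t _ => by
      rw [metricMatrix_symm m y t s]; ring
  have hs : ∀ a b : Fin n, (fun z => metricMatrix m z a b) = fun z => metricMatrix m z b a :=
    fun a b => funext fun z => metricMatrix_symm m z a b
  rw [loweredCurvature_eq m hy, loweredCurvature_eq m hy, hquad i l j k, hquad j l i k]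
  simp only [partialDeriv_christoffelLower m hy]
  rw [partialDeriv_comm (contDiffAt_metricMatrix m hy k l) i j, hs l k]
  rw [partialDeriv_comm (contDiffAt_metricMatrix m hy k l) i j]
  ring

/-- The Riemann curvature tensor is a linear combination of squares of decomposable 2-forms. -/
theorem riemannForm_mem_decomposableSquares (m : M) :
    riemannForm n m ∈ decomposableSquares (TangentSpace (𝓡 n) m) 2 := by
  have hy := mem_extChartAt_target (I := 𝓡 n) m
  refine Submodule.smul_mem _ _ (curvature_mem_decomposableSquares
    (R := fun i j k l => loweredCurvature m i j k l (extChartAt (𝓡 n) m m))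
    (fun i j k l => loweredCurvature_swap_left m i j k l _)
    (fun i j k l => loweredCurvature_swap_right m hy i j k l) (fun i j k l => ?_)
    (coordDifferential m))
  -- Antisymmetry moves the fixed index from third to last place.
  rw [loweredCurvature_swap_right m hy i j l k, loweredCurvature_swap_right m hy j k l i,
    loweredCurvature_swap_right m hy k i l j]
  linarith [loweredCurvature_cyclic m i j k l (extChartAt (𝓡 n) m m)]

end CurvatureSymmetries

end

/-! ### The theorem on a Riemannian manifold -/

theorem mainTheorem9 {n : ℕ} {M : Type*} [TopologicalSpace M]
    [ChartedSpace (EuclideanSpace ℝ (Fin n)) M] [IsManifold (𝓡 n) ∞ M]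
    [RiemannianBundle (fun x : M => TangentSpace (𝓡 n) x)]
    [IsContMDiffRiemannianBundle (𝓡 n) ∞ (EuclideanSpace ℝ (Fin n))
      (fun x : M => TangentSpace (𝓡 n) x)]
    (q : ℕ) (hq : 1 ≤ q) :
    -- 1) on all of `M`, and more generally on any set `S` of points (such as a single point)
    (∀ p : ℕ, 2 * q ≤ p → p + 2 * q ≤ n → ∀ (S : Set M) (a : ℝ),
      (∀ m ∈ S, HasConstantSectionalCurvature p (pqCurvatureTensor (riemannForm n m) p q) a) ↔
      (∀ m ∈ S, HasConstantSectionalCurvature (2 * q) (riemannForm n m ^ q)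
        (a * (2 * q).factorial * (n - p - 2 * q).factorial / (n - p).factorial))) ∧
    -- 2) likewise
    (∀ p : ℕ, p < 2 * q → p + 2 * q ≤ n → ∀ S : Set M,
      (∃ a : ℝ, ∀ m ∈ S,
        HasConstantSectionalCurvature p (pqCurvatureTensor (riemannForm n m) p q) a) ↔
      (∃ b : ℝ, ∀ m ∈ S, (contraction ^ (2 * q - p)) (riemannForm n m ^ q) =
        b • metricForm (TangentSpace (𝓡 n) m) ^ p)) ∧
    -- the lemma, at each point
    (∀ p : ℕ, p < 2 * q → ∀ (m : M) (η : ℕ → DoubleForms (TangentSpace (𝓡 n) m)),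
      (∀ i ≤ 2 * q, η i ∈ effective (TangentSpace (𝓡 n) m) i i) →
      riemannForm n m ^ q =
        ∑ i ∈ Finset.range (2 * q + 1), metricForm (TangentSpace (𝓡 n) m) ^ (2 * q - i) * η i →
      (∀ i ≤ p, n < i + 2 * q → η i = 0) →
      ((∃ b : ℝ, (contraction ^ (2 * q - p)) (riemannForm n m ^ q) =
          b • metricForm (TangentSpace (𝓡 n) m) ^ p) ↔
        ∀ i, 1 ≤ i → i ≤ min p (n - p) → η i = 0)) := by
  have hfin : ∀ m : M, finrank ℝ (TangentSpace (𝓡 n) m) = n := fun m =>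
    finrank_euclideanSpace_fin (𝕜 := ℝ) (n := n)
  have hR : ∀ m : M, riemannForm n m ∈ decomposableSquares (TangentSpace (𝓡 n) m) 2 :=
    riemannForm_mem_decomposableSquares
  refine ⟨fun p hp hpn S a => ?_, fun p hp hpn S => ?_, fun p hp m η hη hsum h0 => ?_⟩
  · refine forall₂_congr fun m _ => ?_
    have := hasConstant_pqCurvature_iff_of_two_mul_le (hR m) hp (by rw [hfin]; exact hpn) a
    rwa [hfin] at this
  · obtain ⟨C, hC, h⟩ := exists_hasConstant_pqCurvature_iff_contraction hp hpn
    have h' := fun m => h (TangentSpace (𝓡 n) m) (hfin m) (riemannForm n m) (hR m)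
    constructor
    · rintro ⟨a, ha⟩
      exact ⟨a * C, fun m hm => (h' m a).1 (ha m hm)⟩
    · rintro ⟨b, hb⟩
      -- C is independent of the point, so a single constant b / C works on all of S.
      refine ⟨b / C, fun m hm => (h' m (b / C)).2 ((hb m hm).trans ?_)⟩
      rw [div_mul_cancel₀ _ hC]
  · exact contraction_pow_eq_smul_metricForm_pow_iff (V := TangentSpace (𝓡 n) m) (hfin m) hp hη
      hsum h0
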